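/- Let $p\geq 3$ be a prime. Let $\widetilde V$ be an $\mathbf F_p$-vector space of dimension $2\sigma_0+2$ with a non-degenerate symmetric bilinear form that is non-neutral, i.e. $\widetilde V$ has no totally isotropic subspace of dimension $\sigma_0+1$. Let $v\in\widetilde V$ be non-zero with $v^2=0$, and let $V=v^\perp/v$ with the induced form. Let $w\in\widetilde V$ satisfy $w^2=0$ and $v\cdot w=-1$. Identify $V$ with $\langle v,w\rangle^\perp\subset\widetilde V$, so that $\widetilde V=V\oplus U_2$ is an orthogonal decomposition with $U_2=\langle v,w\rangle$. For a scheme $S$ over $\mathbf F_p$ and a submodule $K\subset V\otimes\mathcal O_S$, let $F^*$ be the map $x\otimes s\mapsto x\otimes s^p$ of $V\otimes \mathcal O_S$, and let $F^*K$ be the submodule generated by the image of $K$. A characteristic subspace of $V\otimes\mathcal O_S$ is a totally isotropic submodule $K$ such that $K$ and $K+F^*K$ are locally free of ranks $\sigma_0$ and $\sigma_0+1$ and are locally direct summands of $V\otimes\mathcal O_S$. Let $M_V$ be the functor on $\mathbf F_p$-schemes sending $S$ to the set of characteristic subspaces of $V\otimes\mathcal O_S$. Let $M_{\widetilde V}$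 be the same functor for $\widetilde V$, with $\sigma_0+1$ in place of $\sigma_0$. (Both are schemes, by Ogus.) Let $M^{\langle v\rangle}_{\widetilde V}\subset M_{\widetilde V}$ be the open locus of those $\widetilde K$ whose fibre $\widetilde K\otimes k\subset\widetilde V\otimes k$ at every geometric point $\operatorname{Spec}k\to S$ does not contain $v$. Let $\mathcal U_V\to M_V$ be the kernel of $$1-F^*\colon\ (V\otimes\mathcal O)/K\ \longrightarrow\ (V\otimes\mathcal O)/(K+F^*K),$$ where $K$ is the tautological subspace: an $S$-point of $\mathcal U_V$ is a characteristic subspace $K\subset V\otimes\mathcal O_S$ together with a global section $B$ of the quotient sheaf $(V\otimes\mathcal O_S)/K$ with $(1-F^*)B=0$ in $(V\otimes\mathcal O_S)/(K+F^*K)$. Then sending $\widetilde K$ to the image of $\widetilde K\cap(v^\perp\otimes\mathcal O_S)$ in $V\otimes\mathcal O_S$ defines a morphism $\pi_v\colon M^{\langle v\rangle}_{\widetilde V}\to M_V$, and there is an isomorphism $\mathcal U_V\cong M^{\langle v\rangle}_{\widetilde V}$ over $M_V$. It sends $(K,B)$ to the subspace given locally by $$\Big\langle x_1+(x_1\cdot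 B)v,\ \dots,\ x_{\sigma_0}+(x_{\sigma_0}\cdot B)v,\ w+B+\tfrac{B^2}{2}v\Big\rangle\subset\widetilde V\otimes\mathcal O_S,$$ where $x_1,\dots,x_{\sigma_0}$ generate $K$ locally and $B$ also denotes any local lift of the section to $V\otimes\mathcal O_S$. -/

import Mathlib

open CategoryTheory AlgebraicGeometry Opposite
open scoped TensorProduct

universe u v

noncomputable section

namespace CharSubspaces

/-! ### Linear algebra over `F_p`-algebras -/

section Algebra

variable {p : ℕ} {R R' R'' : Type u} [CommRing R] [CommRing R'] [CommRing R'']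
  [Algebra (ZMod p) R] [Algebra (ZMod p) R'] [Algebra (ZMod p) R'']
  {V : Type v} [AddCommGroup V] [Module (ZMod p) V]

/-- A ring homomorphism between `F_p`-algebras is an `F_p`-algebra homomorphism. -/
def toZModAlgHom (p : ℕ) {R R' : Type u} [CommRing R] [CommRing R']
    [Algebra (ZMod p) R] [Algebra (ZMod p) R'] (φ : R →+* R') : R →ₐ[ZMod p] R' :=
  { φ with
    commutes' := fun a =>
      RingHom.congr_fun (RingHom.ext_zmod (φ.comp (algebraMap (ZMod p) R)) _) a }

/-- The `φ`-semilinear map `R ⊗ V → R' ⊗ V`, `r ⊗ x ↦ φ r ⊗ x`. -/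
def scal (V : Type v) [AddCommGroup V] [Module (ZMod p) V] (φ : R →+* R') :
    (R ⊗[ZMod p] V) →ₛₗ[φ] (R' ⊗[ZMod p] V) :=
  { LinearMap.rTensor V (toZModAlgHom p φ).toLinearMap with
    map_smul' := fun r x => by
      change LinearMap.rTensor V (toZModAlgHom p φ).toLinearMap (r • x)
        = φ r • LinearMap.rTensor V (toZModAlgHom p φ).toLinearMap x
      induction x with
      | zero => simp
      | tmul a b => simp [TensorProduct.smul_tmul', toZModAlgHom]
      | add a b ha hb => simp only [smul_add, map_add, ha, hb] }

@[simp]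
theorem scal_tmul (φ : R →+* R') (r : R) (x : V) :
    scal V φ (r ⊗ₜ[ZMod p] x) = φ r ⊗ₜ[ZMod p] x := rfl

theorem scal_scal (φ : R →+* R') (ψ : R' →+* R'') (x : R ⊗[ZMod p] V) :
    scal V ψ (scal V φ x) = scal V (ψ.comp φ) x := by
  induction x with
  | zero => simp
  | tmul a b => rfl
  | add a b ha hb => simp only [map_add, ha, hb]

theorem scal_id (x : R ⊗[ZMod p] V) : scal V (RingHom.id R) x = x := by
  induction x with
  | zero => simp
  | tmul a b => rfl
  | add a b ha hb => simp only [map_add, ha, hb]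

/-- Extension of scalars of a submodule `K ⊆ R ⊗ V` along `φ : R → R'`: the image of
`R' ⊗ K` in `R' ⊗ V`. -/
def push (φ : R →+* R') (K : Submodule R (R ⊗[ZMod p] V)) : Submodule R' (R' ⊗[ZMod p] V) :=
  Submodule.span R' (scal V φ '' (K : Set (R ⊗[ZMod p] V)))

theorem scal_mem_push (φ : R →+* R') {K : Submodule R (R ⊗[ZMod p] V)} {x : R ⊗[ZMod p] V}
    (hx : x ∈ K) : scal V φ x ∈ push φ K :=
  Submodule.subset_span ⟨x, hx, rfl⟩

/-- The map `(R ⊗ V) / K → (R' ⊗ V) / (R' K)` induced by `φ : R → R'`. -/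
def pushQuot (φ : R →+* R') (K : Submodule R (R ⊗[ZMod p] V)) :
    ((R ⊗[ZMod p] V) ⧸ K) →ₛₗ[φ] ((R' ⊗[ZMod p] V) ⧸ push φ K) :=
  K.mapQ (push φ K) (scal V φ) (fun _ hx => scal_mem_push φ hx)

@[simp]
theorem pushQuot_mk (φ : R →+* R') (K : Submodule R (R ⊗[ZMod p] V)) (b : R ⊗[ZMod p] V) :
    pushQuot φ K (Submodule.Quotient.mk b) = Submodule.Quotient.mk (scal V φ b) := rfl

theorem push_span (φ : R →+* R') (s : Set (R ⊗[ZMod p] V)) :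
    push φ (Submodule.span R s) = Submodule.span R' (scal V φ '' s) := by
  apply le_antisymm
  · rw [push, Submodule.span_le]
    rintro _ ⟨x, hx, rfl⟩
    have : Submodule.span R s ≤ (Submodule.span R' (scal V φ '' s)).comap (scal V φ) := by
      rw [Submodule.span_le]
      intro y hy
      exact Submodule.subset_span ⟨y, hy, rfl⟩
    exact this hx
  · exact Submodule.span_mono (Set.image_mono Submodule.subset_span)

theorem push_push (φ : R →+* R') (ψ : R' →+* R'') (K : Submodule R (R ⊗[ZMod p] V)) :
    push ψ (push φ K) = push (ψ.comp φ) K := by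
  refine (push_span ψ _).trans ?_
  rw [push, ← Set.image_comp]
  congr 1
  exact Set.image_congr fun x _ => scal_scal φ ψ x

theorem push_id (K : Submodule R (R ⊗[ZMod p] V)) : push (RingHom.id R) K = K := by
  have : scal V (RingHom.id R) '' (K : Set (R ⊗[ZMod p] V)) = K := by
    ext x; simp [scal_id]
  rw [push, this, Submodule.span_eq]

theorem push_sup (φ : R →+* R') (K L : Submodule R (R ⊗[ZMod p] V)) :
    push φ (K ⊔ L) = push φ K ⊔ push φ L := by
  conv_lhs => rw [← Submodule.span_eq K, ← Submodule.span_eq L, ← Submodule.span_union]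
  rw [push_span, Set.image_union, Submodule.span_union]
  rfl

theorem baseChange_scal (B : LinearMap.BilinForm (ZMod p) V) (φ : R →+* R')
    (x y : R ⊗[ZMod p] V) :
    B.baseChange R' (scal V φ x) (scal V φ y) = φ (B.baseChange R x y) := by
  induction x with
  | zero => simp
  | add a b ha hb => simp only [map_add, LinearMap.add_apply, ha, hb]
  | tmul a m =>
    induction y with
    | zero => simp
    | add a b ha hb => simp only [map_add, ha, hb]
    | tmul b n =>
      simp only [scal_tmul, LinearMap.BilinForm.baseChange_tmul]
      rw [← map_mul]
      exact (map_smul (toZModAlgHom p φ) (B m n) (a * b)).symm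

/-- A basis of `R ⊗ V` induces one of `R' ⊗ V`. -/
theorem exists_basis_scal {ι : Type} (φ : R →+* R') (b : Module.Basis ι R (R ⊗[ZMod p] V)) :
    ∃ b' : Module.Basis ι R' (R' ⊗[ZMod p] V), ∀ i, b' i = scal V φ (b i) := by
  let _ : Algebra R R' := φ.toAlgebra
  have : IsScalarTower (ZMod p) R R' :=
    IsScalarTower.of_algebraMap_eq' (RingHom.ext_zmod _ _)
  let e := TensorProduct.AlgebraTensorModule.cancelBaseChange (ZMod p) R R' R' V
  refine ⟨(b.baseChange R').map e, fun i => ?_⟩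
  rw [Module.Basis.map_apply, Module.Basis.baseChange_apply]
  generalize b i = x
  induction x with
  | zero => simp
  | tmul a m =>
    rw [TensorProduct.AlgebraTensorModule.cancelBaseChange_tmul, scal_tmul, Algebra.smul_def,
      mul_one]
    rfl
  | add a c ha hc => rw [TensorProduct.tmul_add, map_add, map_add, ha, hc]

variable [Fact p.Prime]

/-- The Frobenius `r ↦ r ^ p` of an `F_p`-algebra. -/
def frob (p : ℕ) [Fact p.Prime] (R : Type u) [CommRing R] [Algebra (ZMod p) R] : R →+* R :=
  (FiniteField.frobeniusAlgHom (ZMod p) R : R →+* R)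

theorem frob_apply (r : R) : frob p R r = r ^ p := by
  simp [frob]

theorem frob_comm (φ : R →+* R') : (frob p R').comp φ = φ.comp (frob p R) := by
  ext r; simp [frob_apply]

/-- The submodule `K + F^* K` of `R ⊗ V`, where `F^* K` is the submodule generated by the
image of `K` under `F^* : r ⊗ x ↦ r ^ p ⊗ x`. -/
def addFrob (K : Submodule R (R ⊗[ZMod p] V)) : Submodule R (R ⊗[ZMod p] V) :=
  K ⊔ push (frob p R) K

theorem push_addFrob (φ : R →+* R') (K : Submodule R (R ⊗[ZMod p] V)) :
    push φ (addFrob K) = addFrob (push φ K) := by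
  rw [addFrob, addFrob, push_sup, push_push, push_push, frob_comm]

/-- The additive map `1 - F^* : (R ⊗ V) / K → (R ⊗ V) / (K + F^* K)`. -/
def oneSubFrob (K : Submodule R (R ⊗[ZMod p] V)) :
    ((R ⊗[ZMod p] V) ⧸ K) →+ ((R ⊗[ZMod p] V) ⧸ addFrob K) :=
  (K.mapQ (addFrob K) LinearMap.id (fun _ hx => Submodule.mem_sup_left hx)).toAddMonoidHom
  - (K.mapQ (addFrob K) (scal V (frob p R))
      (fun _ hx => Submodule.mem_sup_right (scal_mem_push _ hx))).toAddMonoidHom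

@[simp]
theorem oneSubFrob_mk (K : Submodule R (R ⊗[ZMod p] V)) (b : R ⊗[ZMod p] V) :
    oneSubFrob K (Submodule.Quotient.mk b)
      = Submodule.Quotient.mk (b - scal V (frob p R) b) := rfl

end Algebra

/-! ### Schemes over `F_p` -/

/-- The category of schemes over `Spec F_p`. -/
abbrev FpScheme (p : ℕ) : Type (u + 1) := Over (Spec (CommRingCat.of (ULift.{u} (ZMod p))))

section Schemes

variable {p : ℕ}

/-- The structure morphism of `X` makes its rings of sections `F_p`-algebras. -/
instance sectionsAlgebra (X : FpScheme.{u} p) (U : X.left.Opens) :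
    Algebra (ZMod p) Γ(X.left, U) :=
  RingHom.toAlgebra <|
    (X.left.presheaf.map (homOfLE (le_top : U ≤ ⊤)).op).hom.comp <|
      X.hom.appTop.hom.comp <|
        (Scheme.ΓSpecIso (CommRingCat.of (ULift.{u} (ZMod p)))).inv.hom.comp
          (ULift.ringEquiv (R := ZMod p)).symm.toRingHom

/-- The structure morphism of `X` makes its local rings `F_p`-algebras. -/
instance stalkAlgebra (X : FpScheme.{u} p) (x : X.left) :
    Algebra (ZMod p) (X.left.presheaf.stalk x) :=
  RingHom.toAlgebra <|
    (X.left.presheaf.germ ⊤ x trivial).hom.comp (algebraMap (ZMod p) Γ(X.left, ⊤))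

variable (V : Type v) [AddCommGroup V] [Module (ZMod p) V]

/-- The `𝒪_X(U)`-module of sections over `U` of the sheaf `V ⊗ 𝒪_X`
(`V` will be finite-dimensional). -/
abbrev VSec (X : FpScheme.{u} p) (U : X.left.Opens) : Type (max u v) :=
  Γ(X.left, U) ⊗[ZMod p] V

/-- The stalk at `x` of the sheaf `V ⊗ 𝒪_X`. -/
abbrev VStalk (X : FpScheme.{u} p) (x : X.left) : Type (max u v) :=
  X.left.presheaf.stalk x ⊗[ZMod p] V

/-- A family of submodules of the stalks of `V ⊗ 𝒪_X`. A subsheaf of `𝒪_X`-modules of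
`V ⊗ 𝒪_X` is determined by its stalks; a family comes from a subsheaf exactly when it is locally
generated by sections, which is part of `IsLocallySplit` below. -/
abbrev StalkFamily (X : FpScheme.{u} p) : Type (max u v) :=
  ∀ x : X.left, Submodule (X.left.presheaf.stalk x) (VStalk V X x)

variable {V}

/-- The germ at `x` of a section of `V ⊗ 𝒪_X`. -/
def germV {X : FpScheme.{u} p} {U : X.left.Opens} (x : X.left) (hx : x ∈ U) (s : VSec V X U) :
    VStalk V X x :=
  scal V (X.left.presheaf.germ U x hx).hom s

/-- The map on local rings induced by a morphism. -/
abbrev stalkHom {T X : FpScheme.{u} p} (f : T ⟶ X) (t : T.left) :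
    X.left.presheaf.stalk (f.left t) →+* T.left.presheaf.stalk t :=
  (f.left.stalkMap t).hom

theorem scal_stalkHom_germV {T X : FpScheme.{u} p} (f : T ⟶ X) {U : X.left.Opens} (t : T.left)
    (ht : f.left t ∈ U) (s : VSec V X U) :
    scal V (stalkHom f t) (germV (f.left t) ht s)
      = germV (U := f.left ⁻¹ᵁ U) t ht (scal V (f.left.app U).hom s) := by
  have h : (stalkHom f t).comp (X.left.presheaf.germ U (f.left t) ht).hom
      = (T.left.presheaf.germ (f.left ⁻¹ᵁ U) t ht).hom.comp (f.left.app U).hom := by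
    rw [← CommRingCat.hom_comp, ← CommRingCat.hom_comp, Scheme.Hom.germ_stalkMap]
  unfold germV
  refine (scal_scal _ _ s).trans (Eq.trans ?_ (scal_scal _ _ s).symm)
  rw [h]

/-- The subsheaf with stalks `K` is, locally on `X`, free of rank `r` with a free complement in
`V ⊗ 𝒪_X`: locally it is generated by the first `r` members of a basis of `V ⊗ 𝒪_X`. In other
words, it is locally free of rank `r` and locally a direct summand of `V ⊗ 𝒪_X`. -/
def IsLocallySplit {X : FpScheme.{u} p} (r : ℕ) (K : StalkFamily V X) : Prop :=
  ∀ x : X.left, ∃ U : X.left.Opens, x ∈ U ∧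
    ∃ (m : ℕ) (b : Module.Basis (Fin r ⊕ Fin m) Γ(X.left, U) (VSec V X U)),
      ∀ (y : X.left) (hy : y ∈ U),
        K y = Submodule.span _ (Set.range fun i : Fin r => germV y hy (b (Sum.inl i)))

/-- The pullback `f^* K ⊆ V ⊗ 𝒪_T` of a subsheaf of `V ⊗ 𝒪_X` (image of `f^* K` in
`f^* (V ⊗ 𝒪_X) = V ⊗ 𝒪_T`). -/
def StalkFamily.pullback {T X : FpScheme.{u} p} (f : T ⟶ X) (K : StalkFamily V X) :
    StalkFamily V T :=
  fun t => push (stalkHom f t) (K (f.left t))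

theorem IsLocallySplit.pullback {T X : FpScheme.{u} p} (f : T ⟶ X) {r : ℕ} {K : StalkFamily V X}
    (h : IsLocallySplit r K) : IsLocallySplit r (K.pullback f) := by
  intro t
  obtain ⟨U, hU, m, b, hb⟩ := h (f.left t)
  obtain ⟨b', hb'⟩ := exists_basis_scal (R' := Γ(T.left, f.left ⁻¹ᵁ U)) (f.left.app U).hom b
  refine ⟨f.left ⁻¹ᵁ U, hU, m, b', fun y hy => ?_⟩
  rw [StalkFamily.pullback, hb (f.left y) hy, push_span, ← Set.range_comp]
  congr 2
  funext i
  rw [hb']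
  exact scal_stalkHom_germV f y hy _

theorem stalkHom_id {X : FpScheme.{u} p} (x : X.left) : stalkHom (𝟙 X) x = RingHom.id _ := by
  change ((𝟙 X.left : X.left ⟶ X.left).stalkMap x).hom = _
  rw [Scheme.Hom.stalkMap_id]
  rfl

theorem stalkHom_comp {Z T X : FpScheme.{u} p} (g : Z ⟶ T) (f : T ⟶ X) (z : Z.left) :
    stalkHom (g ≫ f) z = (stalkHom g z).comp (stalkHom f (g.left z)) := by
  change ((g.left ≫ f.left).stalkMap z).hom = _
  rw [Scheme.Hom.stalkMap_comp]
  rfl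

theorem StalkFamily.pullback_id {X : FpScheme.{u} p} (K : StalkFamily V X) :
    K.pullback (𝟙 X) = K := by
  funext x
  rw [StalkFamily.pullback, stalkHom_id]
  exact push_id _

theorem StalkFamily.pullback_comp {Z T X : FpScheme.{u} p} (g : Z ⟶ T) (f : T ⟶ X)
    (K : StalkFamily V X) : K.pullback (g ≫ f) = (K.pullback f).pullback g := by
  funext z
  rw [StalkFamily.pullback, stalkHom_comp]
  exact (push_push _ _ _).symm

/-- The additive group of global sections of the quotient sheaf `(V ⊗ 𝒪_X) / K`: families of
elements of the stalks which locally come from sections of `V ⊗ 𝒪_X`. -/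
def quotSections {X : FpScheme.{u} p} (K : StalkFamily V X) :
    AddSubgroup (∀ x : X.left, VStalk V X x ⧸ K x) where
  carrier := {s | ∀ x : X.left, ∃ U : X.left.Opens, x ∈ U ∧ ∃ b : VSec V X U,
    ∀ (y : X.left) (hy : y ∈ U), s y = Submodule.Quotient.mk (germV y hy b)}
  zero_mem' := fun x => ⟨⊤, trivial, 0, fun y hy => by simp [germV]⟩
  neg_mem' := by
    intro s hs x
    obtain ⟨U, hU, b, hb⟩ := hs x
    exact ⟨U, hU, -b, fun y hy => by simp [germV, hb y hy]⟩
  add_mem' := by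
    intro s s' hs hs' x
    obtain ⟨U, hU, b, hb⟩ := hs x
    obtain ⟨U', hU', b', hb'⟩ := hs' x
    refine ⟨U ⊓ U', ⟨hU, hU'⟩,
      scal V (X.left.presheaf.map (homOfLE (inf_le_left : U ⊓ U' ≤ U)).op).hom b
        + scal V (X.left.presheaf.map (homOfLE (inf_le_right : U ⊓ U' ≤ U')).op).hom b',
      fun y hy => ?_⟩
    rw [Pi.add_apply, hb y hy.1, hb' y hy.2, germV, germV, germV, map_add, scal_scal, scal_scal,
      ← CommRingCat.hom_comp, ← CommRingCat.hom_comp, TopCat.Presheaf.germ_res,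
      TopCat.Presheaf.germ_res]
    rfl

variable [Fact p.Prime]

/-- The subsheaf `K + F_X^* K` of `V ⊗ 𝒪_X`, where `F_X` is the absolute Frobenius. -/
abbrev StalkFamily.addFrob {X : FpScheme.{u} p} (K : StalkFamily V X) : StalkFamily V X :=
  fun x => CharSubspaces.addFrob (K x)

theorem StalkFamily.pullback_addFrob {T X : FpScheme.{u} p} (f : T ⟶ X) (K : StalkFamily V X) :
    K.addFrob.pullback f = (K.pullback f).addFrob :=
  funext fun _ => push_addFrob _ _

/-- The homomorphism `1 - F^*` from the global sections of `(V ⊗ 𝒪_X) / K` to those of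
`(V ⊗ 𝒪_X) / (K + F^* K)`. -/
def quotOneSubFrob {X : FpScheme.{u} p} (K : StalkFamily V X) :
    quotSections K →+ quotSections K.addFrob where
  toFun s := ⟨fun x => oneSubFrob (K x) (s.1 x), fun x => by
    obtain ⟨U, hU, b, hb⟩ := s.2 x
    refine ⟨U, hU, b - scal V (frob p Γ(X.left, U)) b, fun y hy => ?_⟩
    have h := congrArg (fun φ => scal V φ b)
      (frob_comm (p := p) (X.left.presheaf.germ U y hy).hom)
    simp only [hb y hy, oneSubFrob_mk, germV, map_sub, scal_scal]
    exact congrArg (fun z => Submodule.Quotient.mk (scal V _ b - z)) h⟩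
  map_zero' := Subtype.ext <| funext fun x => map_zero (oneSubFrob (K x))
  map_add' s t := Subtype.ext <| funext fun x => map_add (oneSubFrob (K x)) (s.1 x) (t.1 x)

/-! ### Characteristic subspaces -/

/-- A characteristic subspace of `V ⊗ 𝒪_X`, where `V` is an `F_p`-vector space with bilinear
form `B` (of dimension `2 σ`). -/
@[ext]
structure CharSub (B : LinearMap.BilinForm (ZMod p) V) (σ : ℕ) (X : FpScheme.{u} p) :
    Type (max u v) where
  /-- the stalks of the subsheaf `K ⊆ V ⊗ 𝒪_X` -/
  K : StalkFamily V X
  /-- `K` is locally free of rank `σ` and locally a direct summand -/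
  split : IsLocallySplit σ K
  /-- `K + F^* K` is locally free of rank `σ + 1` and locally a direct summand -/
  split_addFrob : IsLocallySplit (σ + 1) K.addFrob
  /-- `K` is totally isotropic -/
  isotropic : ∀ x, ∀ a ∈ K x, ∀ b ∈ K x, B.baseChange (X.left.presheaf.stalk x) a b = 0

/-- The pullback of a characteristic subspace along a morphism of `F_p`-schemes. -/
def CharSub.pullback {B : LinearMap.BilinForm (ZMod p) V} {σ : ℕ} {T X : FpScheme.{u} p}
    (f : T ⟶ X) (K : CharSub B σ X) : CharSub B σ T where
  K := K.K.pullback f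
  split := K.split.pullback f
  split_addFrob := by
    rw [← StalkFamily.pullback_addFrob]
    exact K.split_addFrob.pullback f
  isotropic := by
    intro t a ha b hb
    refine Submodule.span_induction₂ (p := fun a b _ _ =>
      B.baseChange (T.left.presheaf.stalk t) a b = 0) ?_ ?_ ?_ ?_ ?_ ?_ ?_ ha hb
    · rintro _ _ ⟨a, ha, rfl⟩ ⟨b, hb, rfl⟩
      rw [baseChange_scal, K.isotropic _ a ha b hb, map_zero]
    · intro y _; simp
    · intro y _; simp
    · intro x y z _ _ _ h1 h2; simp [h1, h2]
    · intro x y z _ _ _ h1 h2; simp [h1, h2]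
    · intro r x y _ _ h; simp [h]
    · intro r x y _ _ h; simp [h]

/-- The moduli functor `M_V` of characteristic subspaces, on schemes over `F_p`. -/
def charFunctor (B : LinearMap.BilinForm (ZMod p) V) (σ : ℕ) :
    (FpScheme.{u} p)ᵒᵖ ⥤ Type (max u v) where
  obj X := CharSub B σ X.unop
  map f := ↾ fun K => K.pullback f.unop
  map_id X := by
    refine ConcreteCategory.hom_ext _ _ fun K => ?_
    exact CharSub.ext (StalkFamily.pullback_id K.K)
  map_comp f g := by
    refine ConcreteCategory.hom_ext _ _ fun K => ?_
    exact CharSub.ext (StalkFamily.pullback_comp g.unop f.unop K.K)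

/-! ### The group scheme `𝒰_V` -/

/-- A point of `𝒰_V` with values in `X`: an `X`-point `K` of `M_V`, and an element of the kernel
of `1 - F^*` from `Γ(X, (V ⊗ 𝒪_X) / K)` to `Γ(X, (V ⊗ 𝒪_X) / (K + F^* K))`. -/
structure UPoint (B : LinearMap.BilinForm (ZMod p) V) (σ : ℕ) (X : FpScheme.{u} p) :
    Type (max u v) where
  /-- the underlying point of `M_V` -/
  base : CharSub B σ X
  /-- the point of the fibre of `𝒰_V` -/
  sec : (quotOneSubFrob base.K).ker

/-- The value in the stalk at `x` of the section underlying a point of `𝒰_V`. -/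
def UPoint.val {B : LinearMap.BilinForm (ZMod p) V} {σ : ℕ} {X : FpScheme.{u} p}
    (s : UPoint B σ X) (x : X.left) : VStalk V X x ⧸ s.base.K x :=
  s.sec.1.1 x

theorem UPoint.ext_of {B : LinearMap.BilinForm (ZMod p) V} {σ : ℕ} {X : FpScheme.{u} p}
    {s s' : UPoint B σ X} (h : s.base.K = s'.base.K)
    (h' : ∀ x, ∃ b : VStalk V X x,
      s.val x = Submodule.Quotient.mk b ∧ s'.val x = Submodule.Quotient.mk b) : s = s' := by
  obtain ⟨K, s⟩ := s
  obtain ⟨K', s'⟩ := s'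
  obtain rfl : K = K' := CharSub.ext h
  congr 1
  refine Subtype.ext <| Subtype.ext <| funext fun x => ?_
  obtain ⟨b, hb, hb'⟩ := h' x
  exact hb.trans hb'.symm

/-- Pullback of global sections of `(V ⊗ 𝒪_X) / K` along `f`. -/
def quotPullback {T X : FpScheme.{u} p} (f : T ⟶ X) (K : StalkFamily V X)
    (s : quotSections K) : quotSections (K.pullback f) :=
  ⟨fun t => pushQuot (stalkHom f t) (K (f.left t)) (s.1 (f.left t)), fun t => by
    obtain ⟨U, hU, b, hb⟩ := s.2 (f.left t)
    refine ⟨f.left ⁻¹ᵁ U, hU, scal V (f.left.app U).hom b, fun y hy => ?_⟩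
    refine (congrArg (pushQuot (stalkHom f y) (K (f.left y))) (hb (f.left y) hy)).trans ?_
    refine congrArg Submodule.Quotient.mk ?_
    exact scal_stalkHom_germV f y hy b⟩

/-- The pullback of a point of `𝒰_V` along a morphism of `F_p`-schemes. -/
def UPoint.pullback {B : LinearMap.BilinForm (ZMod p) V} {σ : ℕ} {T X : FpScheme.{u} p}
    (f : T ⟶ X) (s : UPoint B σ X) : UPoint B σ T where
  base := s.base.pullback f
  sec := ⟨quotPullback f s.base.K s.sec.1, by
    refine Subtype.ext <| funext fun t => ?_
    have h : oneSubFrob (s.base.K (f.left t)) (s.sec.1.1 (f.left t)) = 0 :=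
      congrFun (congrArg Subtype.val s.sec.2) (f.left t)
    obtain ⟨b, hb⟩ := Submodule.Quotient.mk_surjective _ (s.sec.1.1 (f.left t))
    rw [← hb, oneSubFrob_mk, Submodule.Quotient.mk_eq_zero] at h
    change oneSubFrob (push (stalkHom f t) (s.base.K (f.left t)))
      (pushQuot (stalkHom f t) (s.base.K (f.left t)) (s.sec.1.1 (f.left t))) = 0
    rw [← hb, pushQuot_mk, oneSubFrob_mk, Submodule.Quotient.mk_eq_zero, scal_scal,
      frob_comm, ← scal_scal, ← map_sub, ← push_addFrob]
    exact scal_mem_push _ h⟩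

theorem UPoint.pullback_val {B : LinearMap.BilinForm (ZMod p) V} {σ : ℕ} {T X : FpScheme.{u} p}
    (f : T ⟶ X) (s : UPoint B σ X) (t : T.left) {b : VStalk V X (f.left t)}
    (hb : s.val (f.left t) = Submodule.Quotient.mk b) :
    (s.pullback f).val t = Submodule.Quotient.mk (scal V (stalkHom f t) b) := by
  exact congrArg (pushQuot (stalkHom f t) (s.base.K (f.left t))) hb

/-- The functor of points of `𝒰_V` on schemes over `F_p`. -/
def uFunctor (B : LinearMap.BilinForm (ZMod p) V) (σ : ℕ) :
    (FpScheme.{u} p)ᵒᵖ ⥤ Type (max u v) where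
  obj X := UPoint B σ X.unop
  map f := ↾ fun s => s.pullback f.unop
  map_id X := by
    refine ConcreteCategory.hom_ext _ _ fun s => ?_
    refine UPoint.ext_of (StalkFamily.pullback_id s.base.K) fun x => ?_
    obtain ⟨b, hb⟩ := Submodule.Quotient.mk_surjective _ (UPoint.val s x)
    refine ⟨b, ?_, hb.symm⟩
    refine (UPoint.pullback_val (𝟙 X.unop) s x hb.symm).trans ?_
    rw [stalkHom_id]
    exact congrArg Submodule.Quotient.mk (scal_id b)
  map_comp f g := by
    refine ConcreteCategory.hom_ext _ _ fun s => ?_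
    refine UPoint.ext_of (StalkFamily.pullback_comp g.unop f.unop s.base.K) fun z => ?_
    obtain ⟨b, hb⟩ := Submodule.Quotient.mk_surjective _
      (UPoint.val s (f.unop.left (g.unop.left z)))
    refine ⟨_, ?_, UPoint.pullback_val g.unop (s.pullback f.unop) z
      (UPoint.pullback_val f.unop s _ hb.symm)⟩
    refine (UPoint.pullback_val (g.unop ≫ f.unop) s z hb.symm).trans ?_
    rw [stalkHom_comp]
    exact congrArg Submodule.Quotient.mk (scal_scal _ _ b).symm

/-- The structure morphism `𝒰_V → M_V`. -/
def uProj (B : LinearMap.BilinForm (ZMod p) V) (σ : ℕ) :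
    uFunctor.{u} B σ ⟶ charFunctor.{u} B σ where
  app _ := ↾ fun s => s.base

/-! ### The open locus `M_V^{⟨v⟩}` -/

/-- `K` does not contain `v` at any geometric point of `X`. A geometric point of `X` centred at
`x` with values in an algebraically closed field `k` is a local homomorphism `𝒪_{X,x} → k`, and
the fibre `K ⊗ k ⊆ V ⊗ k` is the extension of scalars of the stalk `K_x`. -/
def CharSub.Avoids {B : LinearMap.BilinForm (ZMod p) V} {σ : ℕ} {X : FpScheme.{u} p}
    (K : CharSub B σ X) (e : V) : Prop :=
  ∀ (x : X.left) (k : Type u) [Field k] [IsAlgClosed k] [Algebra (ZMod p) k]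
    (φ : X.left.presheaf.stalk x →+* k) [IsLocalHom φ],
    (1 : k) ⊗ₜ[ZMod p] e ∉ push φ (K.K x)

theorem CharSub.Avoids.pullback {B : LinearMap.BilinForm (ZMod p) V} {σ : ℕ}
    {T X : FpScheme.{u} p} (f : T ⟶ X) {K : CharSub B σ X} {e : V} (h : K.Avoids e) :
    (K.pullback f).Avoids e := by
  intro t k _ _ _ φ _ hmem
  refine h (f.left t) k (φ.comp (stalkHom f t)) ?_
  rw [← push_push]
  exact hmem

/-- The open subfunctor `M_V^{⟨v⟩}` of `M_V`. -/
def avoidFunctor (B : LinearMap.BilinForm (ZMod p) V) (σ : ℕ) (e : V) :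
    (FpScheme.{u} p)ᵒᵖ ⥤ Type (max u v) where
  obj X := {K : CharSub B σ X.unop // K.Avoids e}
  map f := ↾ fun K => ⟨K.1.pullback f.unop, K.2.pullback f.unop⟩
  map_id X := by
    refine ConcreteCategory.hom_ext _ _ fun K => ?_
    exact Subtype.ext (CharSub.ext (StalkFamily.pullback_id K.1.K))
  map_comp f g := by
    refine ConcreteCategory.hom_ext _ _ fun K => ?_
    exact Subtype.ext (CharSub.ext (StalkFamily.pullback_comp g.unop f.unop K.1.K))

end Schemes

/-! ### The quotient `v^⊥ / v` -/

section Perp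

variable {p : ℕ} {E : Type v} [AddCommGroup E] [Module (ZMod p) E]

/-- The subspace `e^⊥`. -/
def perp (B : LinearMap.BilinForm (ZMod p) E) (e : E) : Submodule (ZMod p) E :=
  LinearMap.ker (B e)

/-- The quotient `e^⊥ / e` (for isotropic `e`). -/
abbrev PerpQuot (B : LinearMap.BilinForm (ZMod p) E) (e : E) : Type v :=
  perp B e ⧸ (Submodule.span (ZMod p) {e}).submoduleOf (perp B e)

theorem form_eq_zero_of_mem {B : LinearMap.BilinForm (ZMod p) E} {e x y : E} (hx : x ∈ perp B e)
    (hy : y ∈ Submodule.span (ZMod p) {e}) : B y x = 0 := by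
  obtain ⟨c, rfl⟩ := Submodule.mem_span_singleton.1 hy
  have : B e x = 0 := hx
  simp [this]

/-- The form on `e^⊥ / e` induced by a symmetric bilinear form. -/
def perpForm (B : LinearMap.BilinForm (ZMod p) E) (hB : B.IsSymm) (e : E) :
    LinearMap.BilinForm (ZMod p) (PerpQuot B e) :=
  LinearMap.liftQ₂ ((Submodule.span (ZMod p) {e}).submoduleOf (perp B e))
    ((Submodule.span (ZMod p) {e}).submoduleOf (perp B e)) (B.restrict (perp B e))
    (fun y hy => by
      refine LinearMap.ext fun x => ?_
      change B y x = 0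
      exact form_eq_zero_of_mem x.2 hy)
    (fun y hy => by
      refine LinearMap.ext fun x => ?_
      change B x y = 0
      exact (hB.eq _ _).trans (form_eq_zero_of_mem x.2 hy))

@[simp]
theorem perpForm_mk (B : LinearMap.BilinForm (ZMod p) E) (hB : B.IsSymm) (e : E)
    (x y : perp B e) :
    perpForm B hB e (Submodule.Quotient.mk x) (Submodule.Quotient.mk y) = B x y := rfl

/-- The embedding `e^⊥ / e → E` given by a vector `w` with `e ⬝ w = -1`, which identifies
`e^⊥ / e` with the orthogonal complement of `⟨e, w⟩`. -/
def perpSplit (B : LinearMap.BilinForm (ZMod p) E) (e w : E) (h : B e w = -1) :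
    PerpQuot B e →ₗ[ZMod p] E :=
  Submodule.liftQ _ ((perp B e).subtype + ((B.flip w).smulRight e).comp (perp B e).subtype)
    (fun y hy => by
      obtain ⟨c, hc⟩ := Submodule.mem_span_singleton.1 hy
      have hc : c • e = (y : E) := hc
      simp [← hc, h])

@[simp]
theorem perpSplit_mk (B : LinearMap.BilinForm (ZMod p) E) (e w : E) (h : B e w = -1)
    (x : perp B e) : perpSplit B e w h (Submodule.Quotient.mk x) = x + B x w • e := rfl

variable {R : Type u} [CommRing R] [Algebra (ZMod p) R]

/-- For a submodule `L ⊆ R ⊗ E`, the image of `L ∩ (R ⊗ e^⊥)` in `R ⊗ (e^⊥ / e)`. -/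
def reduction (B : LinearMap.BilinForm (ZMod p) E) (e : E) (L : Submodule R (R ⊗[ZMod p] E)) :
    Submodule R (R ⊗[ZMod p] PerpQuot B e) :=
  (L.comap ((perp B e).subtype.baseChange R)).map
    (((Submodule.span (ZMod p) {e}).submoduleOf (perp B e)).mkQ.baseChange R)

end Perp

end CharSubspaces

end

open CharSubspaces

/-! Write `F` for the Frobenius `F^*`. Since `E` is the orthogonal sum of `V = e^⊥/e` and the plane
`⟨e, w⟩`, a vector of `R ⊗ E` is a triple: `x` in `R ⊗ V`, a coefficient `s` of `w` and a
coefficient `t` of `e`.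

The core is local algebra. Let `L` be totally isotropic and split of rank `σ + 1` over a local ring,
not containing `e` at geometric points. If every `s`-coordinate on `L` were a non-unit, then `L +
⟨e⟩` would be isotropic of dimension `σ + 2` over an algebraically closed field, too large for a
non-degenerate form in dimension `2σ + 2`. Hence `L` contains some `w + b + t e`
(`exists_asm_one_mem`). Isotropy forces `t = b²/2` and forces every vector of `L` with `s = 0` to be
`x + (x ⬝ b) e`. So `L` is determined by its reduction `Z` to `V` and by `b` modulo `Z`: it is
`liftSub Z b` (`eq_liftSub`). Conversely, `liftSub Z b` is isotropic and depends only on the class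
of `b` when `Z` is isotropic.

It remains to match the Frobenius conditions. If `b - F b` lies in `Z + F Z`, then `b` can be
changed within its class so that `F b - b` lies in `F Z`; then `L + F L` is the lift of `Z + F Z` by
the same `b` (`addFrob_liftSub`), so its rank is one more. Conversely, the reduction of `L + F L`
contains both `Z + F Z` and `b - F b`. Non-neutrality gives `Z + F Z` fibre dimension at least `σ +
1`: otherwise the fibre of `Z` would be Frobenius-stable, hence descend to an isotropic
`σ`-dimensional space over `F_p`, and adding `e` would make `E` neutral. As `L + F L` has rank `σ +
2`, its reduction must equal `Z + F Z`, which therefore contains `b - F b`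
(`isSplit_addFrob_of_liftSub`).

The global statement follows stalk by stalk: a locally generated family with split stalks is locally
split (`IsLocallyGenerated.isLocallySplit`), and all constructions commute with base change. -/

noncomputable section

namespace CharSubspaces

/-! ### Coordinates on `R ⊗ E` -/

/-- A hyperbolic pair `e, w` (with `e ⬝ w = -1`) for a symmetric bilinear form. -/
structure HypPair {p : ℕ} {E : Type v} [AddCommGroup E] [Module (ZMod p) E]
    (B : LinearMap.BilinForm (ZMod p) E) (e w : E) : Prop where
  symm : B.IsSymm
  ee : B e e = 0
  ww : B w w = 0
  ew : B e w = -1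

namespace HypPair

section Coordinates

variable {p : ℕ} {E : Type v} [AddCommGroup E] [Module (ZMod p) E]
  {B : LinearMap.BilinForm (ZMod p) E} {e w : E} (h : HypPair B e w)

include h in
theorem we : B w e = -1 := (h.symm.eq _ _).trans h.ew

/-- The form on `e^⊥ / e`. -/
abbrev form : LinearMap.BilinForm (ZMod p) (PerpQuot B e) := perpForm B h.symm e

/-- The projection `E → e^⊥ / e` along `⟨e, w⟩`. -/
def proj : E →ₗ[ZMod p] PerpQuot B e :=
  (Submodule.mkQ _).comp <|
    (LinearMap.id + (B e).smulRight w).codRestrict (perp B e) fun z => by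
      change B e (z + B e z • w) = 0
      simp [h.ew]

theorem proj_mk (x : perp B e) :
    h.proj (x : E) = (Submodule.Quotient.mk x : PerpQuot B e) := by
  change Submodule.Quotient.mk _ = _
  congr 1
  have hx : B e x = 0 := x.2
  exact Subtype.ext (by simp [hx])

theorem proj_e : h.proj e = 0 := by
  have : h.proj e = (Submodule.Quotient.mk (⟨e, h.ee⟩ : perp B e) : PerpQuot B e) :=
    h.proj_mk ⟨e, h.ee⟩
  rw [this, Submodule.Quotient.mk_eq_zero]
  exact Submodule.mem_span_singleton_self e

theorem proj_w : h.proj w = 0 := by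
  change Submodule.Quotient.mk _ = _
  rw [Submodule.Quotient.mk_eq_zero]
  change w + B e w • w ∈ Submodule.span (ZMod p) {e}
  simp [h.ew]

/-- The minus signs come from `e ⬝ w = -1`: pairing with `e` reads off minus the coefficient of `w`,
and pairing with `w` minus that of `e`. -/
theorem perpSplit_proj (z : E) :
    perpSplit B e w h.ew (h.proj z) - B e z • w - B w z • e = z := by
  change (z + B e z • w) + B (z + B e z • w) w • e - B e z • w - B w z • e = z
  rw [map_add, LinearMap.add_apply, map_smul, LinearMap.smul_apply, h.ww, smul_zero, add_zero,
    h.symm.eq z w]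
  abel

theorem proj_perpSplit (x : PerpQuot B e) : h.proj (perpSplit B e w h.ew x) = x := by
  obtain ⟨x, rfl⟩ := Submodule.Quotient.mk_surjective _ x
  rw [perpSplit_mk, map_add, map_smul, h.proj_e, smul_zero, add_zero, h.proj_mk]

theorem form_e_perpSplit (x : PerpQuot B e) : B e (perpSplit B e w h.ew x) = 0 := by
  obtain ⟨x, rfl⟩ := Submodule.Quotient.mk_surjective _ x
  have hx : B e x = 0 := x.2
  rw [perpSplit_mk, map_add, map_smul, h.ee, hx]; simp

theorem form_w_perpSplit (x : PerpQuot B e) : B w (perpSplit B e w h.ew x) = 0 := by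
  obtain ⟨x, rfl⟩ := Submodule.Quotient.mk_surjective _ x
  rw [perpSplit_mk, map_add, map_smul, h.we, h.symm.eq]; simp

theorem form_perpSplit (x y : PerpQuot B e) :
    B (perpSplit B e w h.ew x) (perpSplit B e w h.ew y) = h.form x y := by
  obtain ⟨x, rfl⟩ := Submodule.Quotient.mk_surjective _ x
  obtain ⟨y, rfl⟩ := Submodule.Quotient.mk_surjective _ y
  have hx : B x e = 0 := (h.symm.eq _ _).trans x.2
  have hy : B e y = 0 := y.2
  rw [perpSplit_mk, perpSplit_mk, perpForm_mk]
  simp [hx, hy, h.ee]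

theorem form_isSymm : h.form.IsSymm := ⟨fun x y => by
  rw [← h.form_perpSplit, ← h.form_perpSplit]; exact h.symm.eq _ _⟩

variable {R R' : Type u} [CommRing R] [Algebra (ZMod p) R] [CommRing R'] [Algebra (ZMod p) R']

/-- The vector of `R ⊗ E` with coordinates `x ∈ R ⊗ e^⊥/e` and `s, t ∈ R`. -/
def asm (x : R ⊗[ZMod p] PerpQuot B e) (s t : R) : R ⊗[ZMod p] E :=
  (perpSplit B e w h.ew).baseChange R x + s ⊗ₜ w + t ⊗ₜ e

/-- The coordinate in `R ⊗ e^⊥/e`. -/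
def cX : R ⊗[ZMod p] E →ₗ[R] R ⊗[ZMod p] PerpQuot B e := h.proj.baseChange R

/-- The coordinate along `w`. -/
def cS (_ : HypPair B e w) : R ⊗[ZMod p] E →ₗ[R] R := -(B.baseChange R (1 ⊗ₜ e))

/-- The coordinate along `e`. -/
def cT (_ : HypPair B e w) : R ⊗[ZMod p] E →ₗ[R] R := -(B.baseChange R (1 ⊗ₜ w))

theorem form_e_baseChange (x : R ⊗[ZMod p] PerpQuot B e) :
    B.baseChange R (1 ⊗ₜ e) ((perpSplit B e w h.ew).baseChange R x) = 0 := by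
  induction x with
  | zero => simp
  | tmul a m => simp [h.form_e_perpSplit]
  | add a b ha hb => simp only [map_add, ha, hb, add_zero]

theorem form_w_baseChange (x : R ⊗[ZMod p] PerpQuot B e) :
    B.baseChange R (1 ⊗ₜ w) ((perpSplit B e w h.ew).baseChange R x) = 0 := by
  induction x with
  | zero => simp
  | tmul a m => simp [h.form_w_perpSplit]
  | add a b ha hb => simp only [map_add, ha, hb, add_zero]

theorem form_baseChange (x y : R ⊗[ZMod p] PerpQuot B e) :
    B.baseChange R ((perpSplit B e w h.ew).baseChange R x)
      ((perpSplit B e w h.ew).baseChange R y) = h.form.baseChange R x y := by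
  induction x with
  | zero => simp
  | add a b ha hb => simp only [map_add, LinearMap.add_apply, ha, hb]
  | tmul a m =>
    induction y with
    | zero => simp
    | tmul c n => simp [h.form_perpSplit]
    | add a b ha hb => simp only [map_add, ha, hb]

theorem asm_coords (z : R ⊗[ZMod p] E) : h.asm (h.cX z) (h.cS z) (h.cT z) = z := by
  induction z with
  | zero => simp [asm]
  | tmul a m =>
    have hX : h.cX (a ⊗ₜ[ZMod p] m) = a ⊗ₜ h.proj m := rfl
    simp only [asm, hX, cS, cT, LinearMap.neg_apply, LinearMap.BilinForm.baseChange_tmul,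
      LinearMap.baseChange_tmul, one_mul]
    conv_rhs => rw [← h.perpSplit_proj m]
    simp only [TensorProduct.tmul_add, TensorProduct.tmul_neg, TensorProduct.neg_tmul,
      TensorProduct.smul_tmul, TensorProduct.tmul_smul, sub_eq_add_neg]
  | add a b ha hb =>
    conv_rhs => rw [← ha, ← hb]
    simp only [asm, map_add, TensorProduct.add_tmul]
    abel

@[simp]
theorem cX_asm (x : R ⊗[ZMod p] PerpQuot B e) (s t : R) : h.cX (h.asm x s t) = x := by
  have h1 : h.cX ((perpSplit B e w h.ew).baseChange R x) = x := by
    induction x with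
    | zero => simp
    | tmul a m => simp [cX, h.proj_perpSplit]
    | add a b ha hb => simp only [map_add, ha, hb]
  rw [asm, map_add, map_add, h1]
  simp [cX, h.proj_e, h.proj_w]

@[simp]
theorem cS_asm (x : R ⊗[ZMod p] PerpQuot B e) (s t : R) : h.cS (h.asm x s t) = s := by
  simp [asm, cS, h.form_e_baseChange, h.ee, h.ew]

@[simp]
theorem cT_asm (x : R ⊗[ZMod p] PerpQuot B e) (s t : R) : h.cT (h.asm x s t) = t := by
  simp [asm, cT, h.form_w_baseChange, h.ww, h.we]

theorem asm_add (x y : R ⊗[ZMod p] PerpQuot B e) (s t s' t' : R) :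
    h.asm x s t + h.asm y s' t' = h.asm (x + y) (s + s') (t + t') := by
  simp only [asm, map_add, TensorProduct.add_tmul]; abel

theorem asm_sub (x y : R ⊗[ZMod p] PerpQuot B e) (s t s' t' : R) :
    h.asm x s t - h.asm y s' t' = h.asm (x - y) (s - s') (t - t') := by
  simp only [asm, map_sub, TensorProduct.sub_tmul]; abel

theorem asm_smul (r : R) (x : R ⊗[ZMod p] PerpQuot B e) (s t : R) :
    r • h.asm x s t = h.asm (r • x) (r * s) (r * t) := by
  simp only [asm, map_smul, smul_add, TensorProduct.smul_tmul', smul_eq_mul]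

theorem scal_asm (φ : R →+* R') (x : R ⊗[ZMod p] PerpQuot B e) (s t : R) :
    scal E φ (h.asm x s t) = h.asm (scal _ φ x) (φ s) (φ t) := by
  rw [asm, asm, map_add, map_add, scal_tmul, scal_tmul]
  congr 2
  induction x with
  | zero => simp
  | tmul a m => simp
  | add a b ha hb => simp only [map_add, ha, hb]

theorem cX_scal (φ : R →+* R') (z : R ⊗[ZMod p] E) : h.cX (scal E φ z) = scal _ φ (h.cX z) := by
  conv_lhs => rw [← h.asm_coords z, scal_asm, cX_asm]

theorem cS_scal (φ : R →+* R') (z : R ⊗[ZMod p] E) : h.cS (scal E φ z) = φ (h.cS z) := by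
  conv_lhs => rw [← h.asm_coords z, scal_asm, cS_asm]

theorem _root_.CharSubspaces.baseChange_symm {M : Type v} [AddCommGroup M] [Module (ZMod p) M]
    {C : LinearMap.BilinForm (ZMod p) M} (hC : C.IsSymm) (x y : R ⊗[ZMod p] M) :
    C.baseChange R x y = C.baseChange R y x := by
  induction x with
  | zero => simp
  | add a b ha hb => simp only [map_add, LinearMap.add_apply, ha, hb]
  | tmul a m =>
    induction y with
    | zero => simp
    | tmul c n => simp [hC.eq m n, mul_comm a c]
    | add a b ha hb => simp only [map_add, LinearMap.add_apply, ha, hb]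

theorem form_asm (x y : R ⊗[ZMod p] PerpQuot B e) (s t s' t' : R) :
    B.baseChange R (h.asm x s t) (h.asm y s' t')
      = h.form.baseChange R x y - s * t' - t * s' := by
  have e1 : ∀ (r : R) (m : E), r ⊗ₜ[ZMod p] m = r • (1 ⊗ₜ[ZMod p] m) := fun r m => by
    rw [TensorProduct.smul_tmul', smul_eq_mul, mul_one]
  have h1 := (baseChange_symm h.symm ((perpSplit B e w h.ew).baseChange R x) (1 ⊗ₜ w)).trans
    (h.form_w_baseChange x)
  have h2 := (baseChange_symm h.symm ((perpSplit B e w h.ew).baseChange R x) (1 ⊗ₜ e)).trans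
    (h.form_e_baseChange x)
  simp only [asm, e1 s w, e1 t e, e1 s' w, e1 t' e, map_add, map_smul,
    LinearMap.add_apply, LinearMap.smul_apply, h.form_baseChange, h.form_w_baseChange,
    h.form_e_baseChange, h1, h2,
    LinearMap.BilinForm.baseChange_tmul, h.ee, h.ew, h.we, h.ww, smul_eq_mul, mul_one, neg_smul,
    one_smul, zero_smul]
  ring

/-- The image in `R ⊗ e^⊥/e` of the intersection of a submodule with `R ⊗ e^⊥`. -/
theorem mem_reduction {L : Submodule R (R ⊗[ZMod p] E)} {x : R ⊗[ZMod p] PerpQuot B e} :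
    x ∈ reduction B e L ↔ ∃ t, h.asm x 0 t ∈ L := by
  -- On `R ⊗ e^⊥` the projection along `⟨e, w⟩` agrees with the quotient map and the `w`-coordinate
  -- vanishes, so the reduction can be read off in coordinates.
  have key : ∀ z : R ⊗[ZMod p] perp B e,
      h.cX ((perp B e).subtype.baseChange R z) =
        ((Submodule.span (ZMod p) {e}).submoduleOf (perp B e)).mkQ.baseChange R z ∧
      h.cS ((perp B e).subtype.baseChange R z) = 0 := fun z => by
    induction z with
    | zero => simp
    | tmul a m =>
      have hm : B e m = 0 := m.2
      refine ⟨?_, by simp [cS, hm]⟩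
      change a ⊗ₜ h.proj m = a ⊗ₜ _
      rw [h.proj_mk]; rfl
    | add a b ha hb => simp only [map_add, ha, hb, add_zero, and_self]
  constructor
  · rintro ⟨z, hz, rfl⟩
    refine ⟨h.cT ((perp B e).subtype.baseChange R z), ?_⟩
    rw [← (key z).1, ← (key z).2, h.asm_coords]
    exact hz
  · rintro ⟨t, ht⟩
    obtain ⟨z, hz⟩ : ∃ z, (perp B e).subtype.baseChange R z = h.asm x 0 t := by
      let q : PerpQuot B e →ₗ[ZMod p] perp B e :=
        (perpSplit B e w h.ew).codRestrict _ fun y => h.form_e_perpSplit y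
      refine ⟨q.baseChange R x + t ⊗ₜ ⟨e, h.ee⟩, ?_⟩
      rw [map_add, asm, TensorProduct.zero_tmul, add_zero]
      congr 1
      clear ht
      induction x with
      | zero => simp
      | tmul a m => rfl
      | add a b ha hb => rw [map_add, map_add, map_add, ha, hb]
    refine ⟨z, by rw [← hz] at ht; exact ht, ?_⟩
    rw [← (key z).1, hz, cX_asm]

end Coordinates

end HypPair

/-! ### Totally isotropic submodules and their lifts from `e^⊥/e` to `E` -/

/-- A submodule of `R ⊗ M` on which a bilinear form vanishes. -/
def IsIsotropic {p : ℕ} {R : Type u} [CommRing R] [Algebra (ZMod p) R] {M : Type v}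
    [AddCommGroup M] [Module (ZMod p) M] (C : LinearMap.BilinForm (ZMod p) M)
    (K : Submodule R (R ⊗[ZMod p] M)) : Prop :=
  ∀ a ∈ K, ∀ b ∈ K, C.baseChange R a b = 0

theorem IsIsotropic.push {p : ℕ} {R R' : Type u} [CommRing R] [Algebra (ZMod p) R]
    [CommRing R'] [Algebra (ZMod p) R'] {M : Type v}
    [AddCommGroup M] [Module (ZMod p) M] {C : LinearMap.BilinForm (ZMod p) M}
    {K : Submodule R (R ⊗[ZMod p] M)} (hK : IsIsotropic C K) (φ : R →+* R') :
    IsIsotropic C (push φ K) := by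
  intro a ha b hb
  refine Submodule.span_induction₂ (p := fun a b _ _ => C.baseChange R' a b = 0)
    ?_ ?_ ?_ ?_ ?_ ?_ ?_ ha hb
  · rintro _ _ ⟨a, ha, rfl⟩ ⟨b, hb, rfl⟩
    rw [baseChange_scal, hK a ha b hb, map_zero]
  · intro y _; simp
  · intro y _; simp
  · intro x y z _ _ _ h1 h2; simp [h1, h2]
  · intro x y z _ _ _ h1 h2; simp [h1, h2]
  · intro r x y _ _ h; simp [h]
  · intro r x y _ _ h; simp [h]

namespace HypPair

variable {p : ℕ} [Fact p.Prime] {E : Type v} [AddCommGroup E] [Module (ZMod p) E]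
  {B : LinearMap.BilinForm (ZMod p) E} {e w : E} (h : HypPair B e w)
  {R R' : Type u} [CommRing R] [Algebra (ZMod p) R] [CommRing R'] [Algebra (ZMod p) R']

/-- Half the square of a vector of `R ⊗ e^⊥/e`. -/
def halfSq (b : R ⊗[ZMod p] PerpQuot B e) : R := (2 : ZMod p)⁻¹ • h.form.baseChange R b b

theorem two_ne_zero_zmod (hp : p ≠ 2) : (2 : ZMod p) ≠ 0 := by
  intro h2
  have : ((2 : ℕ) : ZMod p) = 0 := by exact_mod_cast h2
  rw [ZMod.natCast_eq_zero_iff] at this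
  exact hp ((Nat.prime_dvd_prime_iff_eq Fact.out Nat.prime_two).1 this)

theorem two_mul_inv_smul (hp : p ≠ 2) (r : R) : 2 * ((2 : ZMod p)⁻¹ • r) = r := by
  rw [Algebra.smul_def, ← mul_assoc]
  have : (2 : R) = algebraMap (ZMod p) R 2 := (map_ofNat (algebraMap (ZMod p) R) 2).symm
  rw [this, ← map_mul, mul_inv_cancel₀ (two_ne_zero_zmod hp), map_one, one_mul]

theorem two_mul_halfSq (hp : p ≠ 2) (b : R ⊗[ZMod p] PerpQuot B e) :
    2 * h.halfSq b = h.form.baseChange R b b := two_mul_inv_smul hp _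

theorem eq_of_two_mul_eq (hp : p ≠ 2) {a b : R} (hab : 2 * a = 2 * b) : a = b := by
  have h1 := two_mul_inv_smul hp a
  have h2 := two_mul_inv_smul hp b
  rw [mul_smul_comm] at h1 h2
  rw [← h1, ← h2, hab]

theorem scal_halfSq (φ : R →+* R') (b : R ⊗[ZMod p] PerpQuot B e) :
    h.halfSq (scal _ φ b) = φ (h.halfSq b) := by
  rw [halfSq, halfSq, baseChange_scal]
  exact (map_smul (toZModAlgHom p φ) _ _).symm

theorem halfSq_add (hp : p ≠ 2) (a b : R ⊗[ZMod p] PerpQuot B e) :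
    h.halfSq (a + b) = h.halfSq a + h.form.baseChange R a b + h.halfSq b := by
  apply eq_of_two_mul_eq hp
  rw [mul_add, mul_add, two_mul_halfSq h hp, two_mul_halfSq h hp, two_mul_halfSq h hp]
  simp only [map_add, LinearMap.add_apply, baseChange_symm h.form_isSymm b a]
  ring

/-- The submodule of `R ⊗ E` generated by the `x + (x ⬝ b) e` with `x ∈ Z` and
`w + b + (b² / 2) e`. -/
def liftSub (Z : Submodule R (R ⊗[ZMod p] PerpQuot B e)) (b : R ⊗[ZMod p] PerpQuot B e) :
    Submodule R (R ⊗[ZMod p] E) :=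
  Z.comap (h.cX - h.cS.smulRight b) ⊓
    LinearMap.ker (h.cT - (LinearMap.flip (h.form.baseChange R) b).comp h.cX + h.halfSq b • h.cS)

/-- With `k = x - s b`, the expected `e`-coordinate `k ⬝ b + s b²/2` becomes `x ⬝ b - s b²/2`. The
equations test membership without choosing generators. -/
theorem asm_mem_liftSub {Z : Submodule R (R ⊗[ZMod p] PerpQuot B e)}
    {b x : R ⊗[ZMod p] PerpQuot B e} {s t : R} :
    h.asm x s t ∈ h.liftSub Z b ↔
      x - s • b ∈ Z ∧ t = h.form.baseChange R x b - s * h.halfSq b := by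
  simp only [liftSub, Submodule.mem_inf, Submodule.mem_comap, LinearMap.mem_ker,
    LinearMap.sub_apply, LinearMap.add_apply, LinearMap.smulRight_apply, cX_asm, cS_asm, cT_asm,
    LinearMap.comp_apply, LinearMap.smul_apply, LinearMap.flip_apply, smul_eq_mul]
  refine and_congr_right fun _ => ⟨fun H => ?_, fun H => ?_⟩
  · linear_combination H
  · linear_combination H

theorem mem_liftSub (hp : p ≠ 2) {Z : Submodule R (R ⊗[ZMod p] PerpQuot B e)}
    {b : R ⊗[ZMod p] PerpQuot B e} {z : R ⊗[ZMod p] E} :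
    z ∈ h.liftSub Z b ↔ ∃ k ∈ Z, ∃ s : R,
      z = h.asm (k + s • b) s (h.form.baseChange R k b + s * h.halfSq b) := by
  have key : ∀ (k : R ⊗[ZMod p] PerpQuot B e) (s : R),
      h.form.baseChange R (k + s • b) b - s * h.halfSq b
        = h.form.baseChange R k b + s * h.halfSq b := fun k s => by
    simp only [map_add, map_smul, LinearMap.add_apply, LinearMap.smul_apply, smul_eq_mul,
      ← two_mul_halfSq h hp b]
    ring
  constructor
  · intro hz
    rw [← h.asm_coords z, asm_mem_liftSub] at hz
    refine ⟨_, hz.1, h.cS z, ?_⟩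
    rw [← key, sub_add_cancel, ← hz.2, h.asm_coords]
  · rintro ⟨k, hk, s, rfl⟩
    rw [asm_mem_liftSub, key]
    simpa using hk

theorem liftSub_span (hp : p ≠ 2) {ι : Type*} (y : ι → R ⊗[ZMod p] PerpQuot B e)
    (b : R ⊗[ZMod p] PerpQuot B e) :
    h.liftSub (Submodule.span R (Set.range y)) b =
      Submodule.span R (Set.range (fun i => h.asm (y i) 0 (h.form.baseChange R (y i) b)) ∪
        {h.asm b 1 (h.halfSq b)}) := by
  apply le_antisymm
  · intro z hz
    obtain ⟨k, hk, s, rfl⟩ := (h.mem_liftSub hp).1 hz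
    have h1 : h.asm (k + s • b) s (h.form.baseChange R k b + s * h.halfSq b)
        = h.asm k 0 (h.form.baseChange R k b) + s • h.asm b 1 (h.halfSq b) := by
      rw [asm_smul, asm_add, zero_add, mul_one]
    rw [h1]
    refine add_mem ?_ (Submodule.smul_mem _ _ (Submodule.subset_span (Or.inr rfl)))
    clear hz h1
    induction hk using Submodule.span_induction with
    | mem x hx =>
      obtain ⟨i, rfl⟩ := hx
      exact Submodule.subset_span (Or.inl ⟨i, rfl⟩)
    | zero => simp [asm]
    | add x y _ _ hx hy =>
      have := add_mem hx hy
      rwa [asm_add, add_zero, ← LinearMap.add_apply, ← map_add] at this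
    | smul r x _ hx =>
      have := Submodule.smul_mem _ r hx
      rwa [asm_smul, mul_zero, ← smul_eq_mul, ← LinearMap.smul_apply, ← map_smul] at this
  · rw [Submodule.span_le]
    rintro _ (⟨i, rfl⟩ | rfl)
    · refine h.asm_mem_liftSub.2 ⟨?_, by simp⟩
      rw [zero_smul, sub_zero]
      exact Submodule.subset_span ⟨i, rfl⟩
    · refine h.asm_mem_liftSub.2 ⟨by simp, ?_⟩
      rw [← two_mul_halfSq h hp b]; ring

/-- Replacing `b` by `b + k` with `k ∈ Z` changes the equation for `t` only by `(x - s b) ⬝ k` and a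
multiple of `k²`, both zero because `Z` is isotropic. This is why only the class of `b` modulo `Z`
matters. -/
theorem liftSub_congr (hp : p ≠ 2) {Z : Submodule R (R ⊗[ZMod p] PerpQuot B e)}
    (hZ : IsIsotropic h.form Z) {b b' : R ⊗[ZMod p] PerpQuot B e} (hb : b' - b ∈ Z) :
    h.liftSub Z b' = h.liftSub Z b := by
  obtain ⟨k, hk, rfl⟩ : ∃ k ∈ Z, b' = b + k := ⟨_, hb, by abel⟩
  ext z
  rw [← h.asm_coords z, asm_mem_liftSub, asm_mem_liftSub]
  generalize h.cX z = x
  generalize h.cS z = s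
  generalize h.cT z = t
  have h1 : x - s • (b + k) = x - s • b - s • k := by rw [smul_add]; abel
  rw [h1, Submodule.sub_mem_iff_left _ (Submodule.smul_mem _ _ hk)]
  refine and_congr_right fun hx => ?_
  have h2 := hZ _ hx _ hk
  have h3 : 2 * h.halfSq k = 0 := (h.two_mul_halfSq hp k).trans (hZ _ hk _ hk)
  have h4 : h.halfSq k = 0 := eq_of_two_mul_eq hp (by rw [h3, mul_zero])
  rw [halfSq_add h hp, h4, map_add, add_zero]
  simp only [map_sub, map_smul, LinearMap.sub_apply, LinearMap.smul_apply, smul_eq_mul] at h2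
  constructor
  · intro H; linear_combination H + h2
  · intro H; linear_combination H - h2

/-- Extension of scalars is visible on generators but not on equations, so `Z` is written as the
span of all its elements and the generator description is used on both sides. -/
theorem push_liftSub (hp : p ≠ 2) (φ : R →+* R') (Z : Submodule R (R ⊗[ZMod p] PerpQuot B e))
    (b : R ⊗[ZMod p] PerpQuot B e) :
    push φ (h.liftSub Z b) = h.liftSub (push φ Z) (scal _ φ b) := by
  have hZ : Z = Submodule.span R (Set.range (Subtype.val : Z → _)) := by
    rw [Subtype.range_coe]; exact (Submodule.span_eq Z).symm
  rw [hZ, liftSub_span h hp, push_span, push_span, ← Set.range_comp, liftSub_span h hp,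
    Set.image_union, Set.image_singleton, ← Set.range_comp]
  congr 3
  · funext i
    simp only [Function.comp_apply, scal_asm, map_zero, baseChange_scal]
  · rw [scal_asm, map_one, scal_halfSq]

theorem reduction_liftSub (Z : Submodule R (R ⊗[ZMod p] PerpQuot B e))
    (b : R ⊗[ZMod p] PerpQuot B e) : reduction B e (h.liftSub Z b) = Z := by
  ext x
  rw [h.mem_reduction]
  simp [asm_mem_liftSub]

theorem asm_mem_liftSub_self (hp : p ≠ 2) (Z : Submodule R (R ⊗[ZMod p] PerpQuot B e))
    (b : R ⊗[ZMod p] PerpQuot B e) : h.asm b 1 (h.halfSq b) ∈ h.liftSub Z b := by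
  refine h.asm_mem_liftSub.2 ⟨by simp, ?_⟩
  rw [← two_mul_halfSq h hp b]; ring

/-- The coefficients `k ⬝ b` and `b²/2` of `e` are exactly those for which the hyperbolic terms
cancel `s' (k ⬝ b) + s (k' ⬝ b) + s s' b²`. -/
theorem isIsotropic_liftSub (hp : p ≠ 2) {Z : Submodule R (R ⊗[ZMod p] PerpQuot B e)}
    (hZ : IsIsotropic h.form Z) (b : R ⊗[ZMod p] PerpQuot B e) :
    IsIsotropic B (h.liftSub Z b) := by
  intro a ha c hc
  obtain ⟨k, hk, s, rfl⟩ := (h.mem_liftSub hp).1 ha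
  obtain ⟨k', hk', s', rfl⟩ := (h.mem_liftSub hp).1 hc
  rw [form_asm]
  simp only [map_add, map_smul, LinearMap.add_apply, LinearMap.smul_apply, smul_eq_mul,
    hZ k hk k' hk', baseChange_symm h.form_isSymm b k', ← two_mul_halfSq h hp b]
  ring

theorem liftSub_sup (hp : p ≠ 2) (Z Z' : Submodule R (R ⊗[ZMod p] PerpQuot B e))
    (b : R ⊗[ZMod p] PerpQuot B e) :
    h.liftSub (Z ⊔ Z') b = h.liftSub Z b ⊔ h.liftSub Z' b := by
  apply le_antisymm
  · intro z hz
    obtain ⟨k, hk, s, rfl⟩ := (h.mem_liftSub hp).1 hz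
    obtain ⟨k₁, h₁, k₂, h₂, rfl⟩ := Submodule.mem_sup.1 hk
    -- The whole multiple of the vector lifting `w` is put into the first summand.
    refine Submodule.mem_sup.2 ⟨_, (h.mem_liftSub hp).2 ⟨k₁, h₁, s, rfl⟩, _,
      (h.mem_liftSub hp).2 ⟨k₂, h₂, 0, rfl⟩, ?_⟩
    rw [asm_add]
    congr 1
    · simp only [zero_smul]; abel
    · ring
    · simp only [map_add, LinearMap.add_apply]; ring
  · refine sup_le (fun z hz => ?_) (fun z hz => ?_)
    · obtain ⟨k, hk, s, rfl⟩ := (h.mem_liftSub hp).1 hz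
      exact (h.mem_liftSub hp).2 ⟨k, Submodule.mem_sup_left hk, s, rfl⟩
    · obtain ⟨k, hk, s, rfl⟩ := (h.mem_liftSub hp).1 hz
      exact (h.mem_liftSub hp).2 ⟨k, Submodule.mem_sup_right hk, s, rfl⟩

/-- Frobenius turns the lift of `Z` by `b` into the lift of `F^* Z` by `F^* b`. The hypothesis on
`b` allows `F^* b` to be replaced by `b`, and two lifts by a common vector add up to the lift of the
sum. -/
theorem addFrob_liftSub (hp : p ≠ 2) {Z : Submodule R (R ⊗[ZMod p] PerpQuot B e)}
    (hZ : IsIsotropic h.form Z) {b : R ⊗[ZMod p] PerpQuot B e}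
    (hb : scal _ (frob p R) b - b ∈ push (frob p R) Z) :
    addFrob (h.liftSub Z b) = h.liftSub (addFrob Z) b := by
  rw [addFrob, push_liftSub h hp, liftSub_congr h hp (hZ.push _) hb, addFrob, liftSub_sup h hp]

/-- Modulo `K`, a vector `b` with `b - F^* b ∈ K + F^* K` can be modified so that
`b - F^* b ∈ F^* K`. -/
theorem exists_sub_frob_mem {M : Type v} [AddCommGroup M] [Module (ZMod p) M]
    {Z : Submodule R (R ⊗[ZMod p] M)} {b : R ⊗[ZMod p] M}
    (hb : b - scal _ (frob p R) b ∈ addFrob Z) :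
    ∃ b', b' - b ∈ Z ∧ scal _ (frob p R) b' - b' ∈ push (frob p R) Z := by
  obtain ⟨k₁, h₁, k₂, h₂, hk⟩ := Submodule.mem_sup.1 hb
  -- With `b - F^* b = k₁ + k₂`, subtracting the part `k₁` in `Z` leaves an error `-(k₂ + F^* k₁)`
  -- in `F^* Z`.
  refine ⟨b - k₁, by simpa using h₁, ?_⟩
  have : scal _ (frob p R) (b - k₁) - (b - k₁) = -(k₂ + scal _ (frob p R) k₁) := by
    rw [map_sub]
    have h3 : scal M (frob p R) b = b - (k₁ + k₂) := by rw [hk]; abel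
    rw [h3]; abel
  rw [this]
  exact neg_mem (add_mem h₂ (scal_mem_push _ h₁))

/-- Isotropy leaves no freedom: the square of `w + b + t e` determines `t`, and its product with a
vector of `w`-coordinate `0` determines the `e`-coordinate of that vector. Any other vector is
brought to `w`-coordinate `0` by subtracting a multiple of `w + b + t e`. -/
theorem eq_liftSub (hp : p ≠ 2) {L : Submodule R (R ⊗[ZMod p] E)} (hL : IsIsotropic B L)
    {b : R ⊗[ZMod p] PerpQuot B e} {t : R} (hb : h.asm b 1 t ∈ L) :
    L = h.liftSub (reduction B e L) b := by
  have ht : t = h.halfSq b := by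
    apply eq_of_two_mul_eq hp
    have := hL _ hb _ hb
    rw [form_asm, ← two_mul_halfSq h hp b] at this
    linear_combination -this
  subst ht
  have key : ∀ x t, h.asm x 0 t ∈ L → t = h.form.baseChange R x b := fun x t hx => by
    have := hL _ hx _ hb
    rw [form_asm] at this
    linear_combination -this
  ext z
  rw [h.mem_liftSub hp]
  constructor
  · intro hz
    have h1 : h.asm (h.cX z - h.cS z • b) 0 (h.cT z - h.cS z * h.halfSq b) ∈ L := by
      have := sub_mem hz (Submodule.smul_mem L (h.cS z) hb)
      rw [← h.asm_coords z, asm_smul, asm_sub, mul_one] at this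
      simpa only [cS_asm, cX_asm, cT_asm, sub_self] using this
    refine ⟨_, h.mem_reduction.2 ⟨_, h1⟩, h.cS z, ?_⟩
    rw [← key _ _ h1, sub_add_cancel, sub_add_cancel, h.asm_coords]
  · rintro ⟨k, hk, s, rfl⟩
    obtain ⟨t, ht⟩ := h.mem_reduction.1 hk
    rw [key _ _ ht] at ht
    have := add_mem ht (Submodule.smul_mem L s hb)
    rwa [asm_smul, asm_add, zero_add, mul_one] at this

end HypPair

/-! ### Split submodules over local rings -/

/-- A submodule generated by the first `r` members of a basis. -/
def IsSplit {R M : Type*} [CommRing R] [AddCommGroup M] [Module R M] (r : ℕ)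
    (K : Submodule R M) : Prop :=
  ∃ (m : ℕ) (b : Module.Basis (Fin r ⊕ Fin m) R M),
    K = Submodule.span R (Set.range fun i : Fin r => b (Sum.inl i))

section Split

variable {p : ℕ} {R R' : Type u} [CommRing R] [CommRing R'] [Algebra (ZMod p) R]
  [Algebra (ZMod p) R'] {M : Type v} [AddCommGroup M] [Module (ZMod p) M]

theorem IsSplit.push {r : ℕ} {K : Submodule R (R ⊗[ZMod p] M)} (hK : IsSplit r K)
    (φ : R →+* R') : IsSplit r (push φ K) := by
  obtain ⟨m, b, rfl⟩ := hK
  obtain ⟨b', hb'⟩ := exists_basis_scal φ b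
  refine ⟨m, b', ?_⟩
  rw [push_span, ← Set.range_comp]
  congr 2
  funext i
  exact (hb' _).symm

theorem IsSplit.finrank_eq {k N : Type*} [Field k] [AddCommGroup N] [Module k N] {r : ℕ}
    {K : Submodule k N} (hK : IsSplit r K) : Module.finrank k K = r := by
  obtain ⟨m, b, rfl⟩ := hK
  exact (finrank_span_eq_card (b.linearIndependent.comp _ Sum.inl_injective)).trans
    (Fintype.card_fin r)

theorem repr_scal {ι : Type} (φ : R →+* R') (b : Module.Basis ι R (R ⊗[ZMod p] M))
    (b' : Module.Basis ι R' (R' ⊗[ZMod p] M)) (hb : ∀ i, b' i = scal M φ (b i))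
    (x : R ⊗[ZMod p] M) (i : ι) : b'.repr (scal M φ x) i = φ (b.repr x i) := by
  classical
  conv_lhs => rw [← b.linearCombination_repr x, Finsupp.linearCombination_apply, Finsupp.sum,
    map_sum, map_sum, Finsupp.finsetSum_apply]
  simp only [map_smulₛₗ, ← hb, RingHom.id_apply, Finsupp.smul_apply, Module.Basis.repr_self,
    smul_eq_mul, Finsupp.single_apply, mul_ite, mul_one, mul_zero, Finset.sum_ite_eq',
    Finsupp.mem_support_iff]
  split_ifs with h0
  · rfl
  · rw [not_not.1 h0, map_zero]

theorem det_scal {ι : Type} [Fintype ι] [DecidableEq ι] (φ : R →+* R')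
    (b : Module.Basis ι R (R ⊗[ZMod p] M))
    (b' : Module.Basis ι R' (R' ⊗[ZMod p] M)) (hb : ∀ i, b' i = scal M φ (b i))
    (f : ι → R ⊗[ZMod p] M) : b'.det (scal M φ ∘ f) = φ (b.det f) := by
  rw [Module.Basis.det_apply, Module.Basis.det_apply, RingHom.map_det]
  congr 1
  ext i j
  simp [Module.Basis.toMatrix_apply, repr_scal φ b b' hb]

theorem scal_surjective {φ : R →+* R'} (hφ : Function.Surjective φ) :
    Function.Surjective (scal (p := p) M φ) := by
  intro x
  induction x with
  | zero => exact ⟨0, map_zero _⟩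
  | tmul a m =>
    obtain ⟨a, rfl⟩ := hφ a
    exact ⟨a ⊗ₜ m, rfl⟩
  | add a b ha hb =>
    obtain ⟨a, rfl⟩ := ha
    obtain ⟨b, rfl⟩ := hb
    exact ⟨a + b, map_add _ _ _⟩

variable [Fact p.Prime]

theorem exists_basis_of_isUnit_det {ι : Type} [Fintype ι] [DecidableEq ι]
    (b : Module.Basis ι R (R ⊗[ZMod p] M)) {f : ι → R ⊗[ZMod p] M} (hf : IsUnit (b.det f)) :
    ∃ b' : Module.Basis ι R (R ⊗[ZMod p] M), ⇑b' = f :=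
  ⟨Module.Basis.mk ((b.is_basis_iff_det).2 hf).1 ((b.is_basis_iff_det).2 hf).2.ge,
    Module.Basis.coe_mk _ _⟩

/-- Vectors with linearly independent images along a surjective local homomorphism to a field
are part of a basis. -/
theorem isSplit_span_of_linearIndependent [FiniteDimensional (ZMod p) M] {k : Type u} [Field k]
    [Algebra (ZMod p) k] {φ : R →+* k} [IsLocalHom φ] (hφ : Function.Surjective φ) {r : ℕ}
    {f : Fin r → R ⊗[ZMod p] M} (hf : LinearIndependent k (scal M φ ∘ f)) :
    IsSplit r (Submodule.span R (Set.range f)) := by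
  classical
  let c := Module.Basis.sumExtend hf
  have : Finite (Module.Basis.sumExtendIndex hf) :=
    have := Module.Finite.finite_basis c
    Finite.of_injective _ (Sum.inr_injective (α := Fin r))
  obtain ⟨m, ⟨g⟩⟩ := Finite.exists_equiv_fin (Module.Basis.sumExtendIndex hf)
  let c' : Module.Basis (Fin r ⊕ Fin m) k (k ⊗[ZMod p] M) :=
    c.reindex ((Equiv.refl _).sumCongr g)
  have hc' : ∀ i, c' (Sum.inl i) = scal M φ (f i) := fun i => by
    change c.reindex _ _ = _
    rw [Module.Basis.reindex_apply]
    change Module.Basis.sumExtend hf (Sum.inl i) = _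
    simp only [Module.Basis.sumExtend, Module.Basis.reindex_apply, Module.Basis.extend_apply_self,
      Trans.trans]
    erw [Equiv.Set.sumDiffSubset_apply_inl]
    · rfl
    · exact hf.linearIndepOn_id.subset_extend _
  choose lift hlift using scal_surjective (p := p) (M := M) hφ
  let F : Fin r ⊕ Fin m → R ⊗[ZMod p] M := Sum.elim f fun j => lift (c' (Sum.inr j))
  have hF : scal M φ ∘ F = c' := by
    funext i
    rcases i with i | j
    · exact (hc' i).symm
    · exact hlift _
  have hcard : Module.finrank (ZMod p) M = Fintype.card (Fin r ⊕ Fin m) := by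
    rw [← Module.finrank_eq_card_basis c', Module.finrank_baseChange]
  let b : Module.Basis (Fin r ⊕ Fin m) R (R ⊗[ZMod p] M) :=
    ((Module.finBasis (ZMod p) M).baseChange R).reindex
      ((finCongr hcard).trans (Fintype.equivFin _).symm)
  obtain ⟨b', hb'⟩ := exists_basis_scal φ b
  -- The lifted vectors reduce to a basis over the field, so their determinant is a unit there,
  -- hence already in `R` since `φ` is local.
  have hdet : IsUnit (b.det F) := by
    apply isUnit_of_map_unit φ
    rw [← det_scal φ b b' hb', hF]
    exact b'.isUnit_det c'
  obtain ⟨d, hd⟩ := exists_basis_of_isUnit_det b hdet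
  refine ⟨m, d, ?_⟩
  rw [hd]
  rfl

/-- A module generated by `r` vectors is generated by any `r` vectors with linearly independent
images over the residue field. -/
theorem le_span_of_linearIndependent {k : Type u} [Field k]
    [Algebra (ZMod p) k] {φ : R →+* k} [IsLocalHom φ] {r : ℕ}
    {g f : Fin r → R ⊗[ZMod p] M}
    (hfg : ∀ i, f i ∈ Submodule.span R (Set.range g))
    (hf : LinearIndependent k (scal M φ ∘ f)) :
    Submodule.span R (Set.range g) ≤ Submodule.span R (Set.range f) := by
  choose A hA using fun i => (Submodule.mem_span_range_iff_exists_fun R).1 (hfg i)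
  let A' : Matrix (Fin r) (Fin r) R := Matrix.of A
  -- A linear relation among the rows of the matrix expressing `f` through `g` would give one among
  -- the images of `f`; so the matrix is invertible over `k`, and over `R` by locality.
  have hk : IsUnit (φ.mapMatrix A') := by
    rw [← Matrix.linearIndependent_rows_iff_isUnit]
    refine LinearIndependent.of_comp (Fintype.linearCombination k (scal M φ ∘ g)) ?_
    convert hf using 1
    funext i
    simp only [Function.comp_apply, Fintype.linearCombination_apply, ← hA i, map_sum, map_smulₛₗ]
    rfl
  have hA' : IsUnit A' := by
    rw [Matrix.isUnit_iff_isUnit_det] at hk ⊢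
    rw [← RingHom.map_det] at hk
    exact isUnit_of_map_unit φ _ hk
  obtain ⟨C, hC⟩ := hA'.exists_left_inv
  rw [Submodule.span_le]
  rintro _ ⟨i, rfl⟩
  have : g i = ∑ j, C i j • f j := by
    have h1 : ∀ j, f j = ∑ l, A' j l • g l := fun j => (hA j).symm
    simp only [h1, Finset.smul_sum, smul_smul]
    rw [Finset.sum_comm]
    simp only [← Finset.sum_smul, ← Matrix.mul_apply, hC, Matrix.one_apply, ite_smul, one_smul,
      zero_smul, Finset.sum_ite_eq, Finset.mem_univ, if_true]
  rw [this]
  exact sum_mem fun j _ => Submodule.smul_mem _ _ (Submodule.subset_span ⟨j, rfl⟩)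

/-- The space `push φ K` is spanned by images of elements of `K`, so a basis can be chosen among
those images. -/
theorem exists_linearIndependent_of_le_finrank_push [FiniteDimensional (ZMod p) M] {k : Type u}
    [Field k] [Algebra (ZMod p) k] (φ : R →+* k) {K : Submodule R (R ⊗[ZMod p] M)} {r : ℕ}
    (hr : r ≤ Module.finrank k (push φ K)) :
    ∃ f : Fin r → R ⊗[ZMod p] M, (∀ i, f i ∈ K) ∧ LinearIndependent k (scal M φ ∘ f) := by
  obtain ⟨f, hf, -, hli⟩ :=
    Submodule.exists_fun_fin_finrank_span_eq k (scal M φ '' (K : Set (R ⊗[ZMod p] M)))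
  choose g hg hgf using hf
  refine ⟨g ∘ Fin.castLE hr, fun i => hg _, ?_⟩
  have : scal M φ ∘ g ∘ Fin.castLE hr = f ∘ Fin.castLE hr := funext fun i => hgf _
  rw [this]
  exact hli.comp _ (Fin.castLE_injective hr)

end Split

/-! ### Frobenius descent -/

section Descent

variable {p : ℕ} [Fact p.Prime] {k : Type u} [Field k] [Algebra (ZMod p) k]

/-- The fixed points of `c ↦ c ^ p` in a field of characteristic `p` form the prime field. -/
theorem exists_algebraMap_of_frob_eq {c : k} (hc : frob p k c = c) :
    ∃ a : ZMod p, algebraMap (ZMod p) k a = c := by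
  have : CharP k p := charP_of_injective_algebraMap (algebraMap (ZMod p) k).injective p
  rw [frob_apply, ← Subfield.mem_bot_iff_pow_eq_self] at hc
  have h2 : (⊥ : Subfield k) ≤ (algebraMap (ZMod p) k).fieldRange := bot_le
  exact h2 hc

variable {M : Type v} [AddCommGroup M] [Module (ZMod p) M]

theorem exists_tmul_of_scal_frob_eq [FiniteDimensional (ZMod p) M] {y : k ⊗[ZMod p] M}
    (hy : scal M (frob p k) y = y) : ∃ m : M, 1 ⊗ₜ m = y := by
  let b := Module.finBasis (ZMod p) M
  let b' := b.baseChange k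
  have hb : ∀ i, b' i = scal M (frob p k) (b' i) := fun i => by
    simp only [b', Module.Basis.baseChange_apply, scal_tmul, map_one]
  have h1 : ∀ i, frob p k (b'.repr y i) = b'.repr y i := fun i => by
    rw [← repr_scal _ b' b' hb, hy]
  choose a ha using fun i => exists_algebraMap_of_frob_eq (h1 i)
  refine ⟨∑ i, a i • b i, ?_⟩
  conv_rhs => rw [← b'.sum_repr y]
  rw [TensorProduct.tmul_sum]
  refine Finset.sum_congr rfl fun i _ => ?_
  rw [← ha i, Module.Basis.baseChange_apply, TensorProduct.tmul_smul, algebraMap_smul]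

/-- A non-zero Frobenius-stable subspace of `k ⊗ M` contains a non-zero vector of `M`. -/
theorem exists_tmul_mem_of_ne_bot [FiniteDimensional (ZMod p) M]
    {K : Submodule k (k ⊗[ZMod p] M)}
    (hK : ∀ x ∈ K, scal M (frob p k) x ∈ K) (hne : K ≠ ⊥) :
    ∃ m : M, m ≠ 0 ∧ (1 : k) ⊗ₜ[ZMod p] m ∈ K := by
  classical
  let b' := (Module.finBasis (ZMod p) M).baseChange k
  have hb : ∀ i, b' i = scal M (frob p k) (b' i) := fun i => by
    simp only [b', Module.Basis.baseChange_apply, scal_tmul, map_one]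
  -- Take a non-zero vector of `K` with fewest non-zero coordinates and scale one coordinate to `1`.
  -- Then `F^* y - y` lies in `K` and has smaller support, so it vanishes and `y` comes from `M`.
  have hex : ∃ n, ∃ x ∈ K, x ≠ 0 ∧ (b'.repr x).support.card = n := by
    obtain ⟨x, hx, hx0⟩ := Submodule.exists_mem_ne_zero_of_ne_bot hne
    exact ⟨_, x, hx, hx0, rfl⟩
  obtain ⟨x, hx, hx0, hn⟩ := Nat.find_spec hex
  have hmin : ∀ y ∈ K, (b'.repr y).support.card < (b'.repr x).support.card → y = 0 := by
    intro y hy hlt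
    by_contra hy0
    exact Nat.find_min hex (hn ▸ hlt) ⟨y, hy, hy0, rfl⟩
  obtain ⟨i, hi⟩ : ∃ i, b'.repr x i ≠ 0 := by
    by_contra! hall
    exact hx0 (b'.repr.map_eq_zero_iff.1 (Finsupp.ext hall))
  let y := (b'.repr x i)⁻¹ • x
  have hyK : y ∈ K := K.smul_mem _ hx
  have hyr : ∀ j, b'.repr y j = (b'.repr x i)⁻¹ * b'.repr x j := fun j => by
    simp [y]
  have hfix : scal M (frob p k) y - y = 0 := by
    refine hmin _ (sub_mem (hK _ hyK) hyK) (Finset.card_lt_card ?_)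
    refine Finset.ssubset_iff_of_subset (fun j hj => ?_) |>.2 ⟨i, Finsupp.mem_support_iff.2 hi, ?_⟩
    · rw [Finsupp.mem_support_iff] at hj ⊢
      intro hj0
      apply hj
      rw [map_sub, Finsupp.sub_apply, repr_scal _ b' b' hb, hyr, hj0, mul_zero, map_zero, sub_zero]
    · rw [Finsupp.notMem_support_iff, map_sub, Finsupp.sub_apply, repr_scal _ b' b' hb, hyr,
        inv_mul_cancel₀ hi, map_one, sub_self]
  obtain ⟨m, hm⟩ := exists_tmul_of_scal_frob_eq (sub_eq_zero.1 hfix)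
  refine ⟨m, ?_, hm ▸ hyK⟩
  rintro rfl
  rw [TensorProduct.tmul_zero] at hm
  have := hyr i
  rw [← hm, map_zero, inv_mul_cancel₀ hi] at this
  exact zero_ne_one this

/-- A Frobenius-stable subspace of `k ⊗ M` is generated by vectors of `M`. -/
theorem le_span_of_frob_stable [FiniteDimensional (ZMod p) M]
    {K : Submodule k (k ⊗[ZMod p] M)} (hK : ∀ x ∈ K, scal M (frob p k) x ∈ K)
    {W : Submodule (ZMod p) M} (hW : ∀ m, m ∈ W ↔ (1 : k) ⊗ₜ[ZMod p] m ∈ K) :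
    K ≤ Submodule.span k ((fun m : M => (1 : k) ⊗ₜ[ZMod p] m) '' W) := by
  have hker : LinearMap.ker (W.mkQ.baseChange k)
      ≤ Submodule.span k ((fun m : M => (1 : k) ⊗ₜ[ZMod p] m) '' W) := by
    intro z hz
    have hex := lTensor_exact k (LinearMap.exact_subtype_mkQ W) W.mkQ_surjective
    obtain ⟨y, rfl⟩ := (hex z).1 hz
    induction y with
    | zero => simp
    | tmul a m =>
      have : LinearMap.lTensor k W.subtype (a ⊗ₜ m) = a • ((1 : k) ⊗ₜ[ZMod p] (m : M)) := by
        rw [TensorProduct.smul_tmul', smul_eq_mul, mul_one]; rfl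
      rw [this]
      exact Submodule.smul_mem _ _ (Submodule.subset_span ⟨m, m.2, rfl⟩)
    | add a b ha hb =>
      rw [map_add]
      have h0 : ∀ c, LinearMap.lTensor k W.subtype c ∈ LinearMap.ker (W.mkQ.baseChange k) :=
        fun c => (hex _).2 ⟨c, rfl⟩
      exact add_mem (ha (h0 a)) (hb (h0 b))
  have hspan : Submodule.span k ((fun m : M => (1 : k) ⊗ₜ[ZMod p] m) '' W) ≤ K := by
    rw [Submodule.span_le]
    rintro _ ⟨m, hm, rfl⟩
    exact (hW m).1 hm
  -- It suffices that `K` dies in `k ⊗ (M / W)`. Its image there is Frobenius-stable; if non-zero,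
  -- it contains a non-zero class of some `m ∈ M`. Then `1 ⊗ m` differs from an element of `K` by
  -- the kernel, which lies in `K`, so `m ∈ W`, a contradiction.
  refine le_trans ?_ hker
  rw [← Submodule.map_le_iff_le_comap.trans (by rfl : _ ↔ K ≤ LinearMap.ker (W.mkQ.baseChange k)),
    le_bot_iff]
  by_contra hne
  obtain ⟨m, hm0, hm⟩ := exists_tmul_mem_of_ne_bot (p := p) (K := K.map (W.mkQ.baseChange k)) (by
    rintro _ ⟨x, hx, rfl⟩
    refine ⟨_, hK x hx, ?_⟩
    clear hx
    induction x with
    | zero => simp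
    | tmul a m => rfl
    | add a b ha hb => simp only [map_add, ha, hb]) hne
  obtain ⟨m, rfl⟩ := W.mkQ_surjective m
  obtain ⟨z, hz, hzm⟩ := hm
  apply hm0
  rw [Submodule.mkQ_apply, Submodule.Quotient.mk_eq_zero, hW]
  have h1 : z - 1 ⊗ₜ m ∈ LinearMap.ker (W.mkQ.baseChange k) := by
    rw [LinearMap.mem_ker, map_sub, hzm]
    simp
  have h2 := sub_mem hz (hspan (hker h1))
  rwa [sub_sub_cancel] at h2

/-- A Frobenius-stable totally isotropic subspace of `k ⊗ M` of dimension `≥ r` gives a totally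
isotropic subspace of `M` of dimension `≥ r`. -/
theorem exists_isotropic_of_frob_stable [FiniteDimensional (ZMod p) M]
    {C : LinearMap.BilinForm (ZMod p) M} {K : Submodule k (k ⊗[ZMod p] M)}
    (hK : ∀ x ∈ K, scal M (frob p k) x ∈ K) (hiso : IsIsotropic C K) :
    ∃ W : Submodule (ZMod p) M, Module.finrank k K ≤ Module.finrank (ZMod p) W ∧
      ∀ x ∈ W, ∀ y ∈ W, C x y = 0 := by
  let W : Submodule (ZMod p) M :=
    (K.restrictScalars (ZMod p)).comap (TensorProduct.mk (ZMod p) k M 1)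
  refine ⟨W, ?_, fun x hx y hy => ?_⟩
  · have hle := le_span_of_frob_stable hK (W := W) (fun m => Iff.rfl)
    let b := Module.finBasis (ZMod p) W
    let g : Fin (Module.finrank (ZMod p) W) → k ⊗[ZMod p] M := fun i => 1 ⊗ₜ (b i : M)
    have hle2 : K ≤ Submodule.span k (Set.range g) := by
      refine hle.trans (Submodule.span_le.2 ?_)
      rintro _ ⟨m, hm, rfl⟩
      have : m = ∑ i, b.repr ⟨m, hm⟩ i • (b i : M) := by
        have := congrArg W.subtype (b.sum_repr ⟨m, hm⟩)
        rw [map_sum] at this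
        exact this.symm
      rw [SetLike.mem_coe, this]
      simp only [TensorProduct.tmul_sum, TensorProduct.tmul_smul]
      refine sum_mem fun i _ => ?_
      rw [← algebraMap_smul k]
      exact Submodule.smul_mem _ _ (Submodule.subset_span ⟨i, rfl⟩)
    calc Module.finrank k K ≤ Module.finrank k (Submodule.span k (Set.range g)) :=
          Submodule.finrank_mono hle2
      _ ≤ _ := (finrank_range_le_card (R := k) g).trans_eq (Fintype.card_fin _)
  · have := hiso _ hx _ hy
    rw [TensorProduct.mk_apply, TensorProduct.mk_apply, LinearMap.BilinForm.baseChange_tmul,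
      mul_one] at this
    exact (smul_eq_zero.1 this).resolve_right one_ne_zero

/-- An isotropic subspace lies in its own orthogonal, whose dimension is complementary once the
extended form is known to be non-degenerate. -/
theorem two_mul_finrank_le_of_isIsotropic [FiniteDimensional (ZMod p) M]
    {C : LinearMap.BilinForm (ZMod p) M} (hC : C.IsSymm) (hnd : C.Nondegenerate)
    {K : Submodule k (k ⊗[ZMod p] M)} (hiso : IsIsotropic C K) :
    2 * Module.finrank k K ≤ Module.finrank (ZMod p) M := by
  let Ck : LinearMap.BilinForm k (k ⊗[ZMod p] M) := C.baseChange k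
  have hsymm : Ck.IsSymm := ⟨fun x y => baseChange_symm hC x y⟩
  -- Pairing with the dual basis recovers the coordinates of `x`, so non-degeneracy survives
  -- extension of scalars.
  have hsep : ∀ x, (∀ y, Ck x y = 0) → x = 0 := by
    intro x hx
    let b := Module.finBasis (ZMod p) M
    let d := C.dualBasis hnd b
    let b' := b.baseChange k
    have h1 : ∀ j, Ck x (1 ⊗ₜ d j) = b'.repr x j := fun j => by
      conv_lhs => rw [← b'.sum_repr x]
      simp only [map_sum, map_smul, LinearMap.sum_apply, LinearMap.smul_apply, b',
        Module.Basis.baseChange_apply, Ck, LinearMap.BilinForm.baseChange_tmul, d,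
        LinearMap.BilinForm.apply_dualBasis_right hnd hC, smul_eq_mul, mul_one, ite_smul, one_smul,
        zero_smul, mul_ite, mul_zero]
      simp
    exact b'.repr.map_eq_zero_iff.1 (Finsupp.ext fun j => by rw [← h1, hx]; rfl)
  have hCk : Ck.Nondegenerate :=
    ⟨hsep, fun y hy => hsep y fun x => (hsymm.eq _ _).trans (hy x)⟩
  have hle : K ≤ Ck.orthogonal K := fun x hx y hy => hiso y hy x hx
  have h1 := Submodule.finrank_mono hle
  rw [LinearMap.BilinForm.finrank_orthogonal hCk, Module.finrank_baseChange] at h1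
  have h2 := Submodule.finrank_le K
  rw [Module.finrank_baseChange] at h2
  omega

end Descent

namespace HypPair

/-! ### Characteristic submodules over a local ring -/

variable {p : ℕ} [Fact p.Prime] {E : Type v} [AddCommGroup E] [Module (ZMod p) E]
  {B : LinearMap.BilinForm (ZMod p) E} {e w : E} (h : HypPair B e w)
  {R : Type u} [CommRing R] [Algebra (ZMod p) R] {k : Type u} [Field k] [Algebra (ZMod p) k]

theorem linearIndependent_cons_asm {r : ℕ} {x : Fin r → k ⊗[ZMod p] PerpQuot B e}
    (hx : LinearIndependent k x) (b : k ⊗[ZMod p] PerpQuot B e) (t₀ : k) (t : Fin r → k) :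
    LinearIndependent k (Fin.cons (h.asm b 1 t₀) fun i => h.asm (x i) 0 (t i) :
      Fin (r + 1) → k ⊗[ZMod p] E) := by
  rw [linearIndependent_finCons]
  constructor
  · refine LinearIndependent.of_comp h.cX ?_
    convert hx using 1
    funext i
    simp
  · intro hmem
    have : Submodule.span k (Set.range fun i => h.asm (x i) 0 (t i)) ≤ LinearMap.ker h.cS := by
      rw [Submodule.span_le]
      rintro _ ⟨i, rfl⟩
      simp
    simpa using this hmem

theorem liftSub_span_fin (hp : p ≠ 2) {r : ℕ} (y : Fin r → R ⊗[ZMod p] PerpQuot B e)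
    (b : R ⊗[ZMod p] PerpQuot B e) :
    h.liftSub (Submodule.span R (Set.range y)) b = Submodule.span R (Set.range
      (Fin.cons (h.asm b 1 (h.halfSq b)) fun i => h.asm (y i) 0 (h.form.baseChange R (y i) b) :
        Fin (r + 1) → R ⊗[ZMod p] E)) := by
  rw [liftSub_span h hp, Fin.range_cons, Set.union_singleton]

theorem scal_comp_cons {r : ℕ} (φ : R →+* k) (b : R ⊗[ZMod p] PerpQuot B e) (t₀ : R)
    (y : Fin r → R ⊗[ZMod p] PerpQuot B e) (t : Fin r → R) :
    scal E φ ∘ (Fin.cons (h.asm b 1 t₀) fun i => h.asm (y i) 0 (t i) :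
        Fin (r + 1) → R ⊗[ZMod p] E)
      = Fin.cons (h.asm (scal _ φ b) 1 (φ t₀)) fun i => h.asm (scal _ φ (y i)) 0 (φ (t i)) := by
  funext i
  refine Fin.cases ?_ (fun j => ?_) i
  · simp [scal_asm]
  · simp [scal_asm]

/-- A vector of the lift is determined by `x - s b ∈ Z` and `s`, since its `e`-coordinate is a
function of the other two. -/
theorem finrank_liftSub_le (Z : Submodule k (k ⊗[ZMod p] PerpQuot B e))
    [FiniteDimensional (ZMod p) E] (b : k ⊗[ZMod p] PerpQuot B e) :
    Module.finrank k (h.liftSub Z b) ≤ Module.finrank k Z + 1 := by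
  let g : h.liftSub Z b →ₗ[k] Z × k :=
    LinearMap.prod
      (((h.cX - h.cS.smulRight b).comp (h.liftSub Z b).subtype).codRestrict Z fun z => z.2.1)
      (h.cS.comp (h.liftSub Z b).subtype)
  have hg : Function.Injective g := by
    rw [injective_iff_map_eq_zero]
    rintro ⟨z, hz⟩ hgz
    have h1 : h.cX z - h.cS z • b = 0 := congrArg (fun q => (q.1 : k ⊗[ZMod p] PerpQuot B e)) hgz
    have h2 : h.cS z = 0 := congrArg Prod.snd hgz
    rw [h2, zero_smul, sub_zero] at h1
    have h3 := hz
    rw [← h.asm_coords z, asm_mem_liftSub, h1, h2] at h3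
    refine Subtype.ext ?_
    change z = 0
    rw [← h.asm_coords z, h1, h2, h3.2]
    simp [asm]
  have hfree : Module.Free k Z := Module.Free.of_divisionRing k Z
  have hfin : Module.Finite k Z := FiniteDimensional.finiteDimensional_submodule Z
  have := LinearMap.finrank_le_finrank_of_injective hg
  rwa [Module.finrank_prod, Module.finrank_self] at this

variable {φ : R →+* k} [IsLocalHom φ]

theorem isSplit_liftSub [FiniteDimensional (ZMod p) E] (hp : p ≠ 2)
    (hφ : Function.Surjective φ) {r : ℕ}
    {Z : Submodule R (R ⊗[ZMod p] PerpQuot B e)} (hZ : IsSplit r Z)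
    (b : R ⊗[ZMod p] PerpQuot B e) : IsSplit (r + 1) (h.liftSub Z b) := by
  obtain ⟨m, c, rfl⟩ := hZ
  obtain ⟨c', hc'⟩ := exists_basis_scal φ c
  rw [liftSub_span_fin h hp]
  refine isSplit_span_of_linearIndependent hφ ?_
  rw [scal_comp_cons]
  refine h.linearIndependent_cons_asm ?_ _ _ _
  have hcc : (fun i => scal _ φ (c (Sum.inl i))) = c' ∘ (Sum.inl : Fin r → _) :=
    funext fun i => (hc' _).symm
  exact hcc ▸ c'.linearIndependent.comp _ Sum.inl_injective

/-- If `N` is split of rank `r + 1` and contains lifts of a vector of the form `w + b + t e` and of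
`r` vectors `u i` that are linearly independent over the residue field, then the reduction of `N`
is generated by the `u i`. -/
theorem reduction_le_span {r : ℕ} {N : Submodule R (R ⊗[ZMod p] E)} (hN : IsSplit (r + 1) N)
    {b : R ⊗[ZMod p] PerpQuot B e} {t : R} (hb : h.asm b 1 t ∈ N)
    {x : Fin r → R ⊗[ZMod p] PerpQuot B e} (hx : ∀ i, x i ∈ reduction B e N)
    (hli : LinearIndependent k (scal _ φ ∘ x)) :
    reduction B e N ≤ Submodule.span R (Set.range x) := by
  obtain ⟨m, c, rfl⟩ := hN
  choose s hs using fun i => h.mem_reduction.1 (hx i)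
  have hle := le_span_of_linearIndependent (φ := φ)
    (g := fun i => c (Sum.inl i))
    (f := (Fin.cons (h.asm b 1 t) fun i => h.asm (x i) 0 (s i) : Fin (r + 1) → R ⊗[ZMod p] E))
    (fun i => Fin.cases hb hs i) (by
      rw [scal_comp_cons]
      exact h.linearIndependent_cons_asm hli _ _ _)
  intro y hy
  obtain ⟨q, hq⟩ := h.mem_reduction.1 hy
  obtain ⟨a, ha⟩ := (Submodule.mem_span_range_iff_exists_fun R).1 (hle hq)
  rw [Fin.sum_univ_succ] at ha
  simp only [Fin.cons_zero, Fin.cons_succ] at ha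
  -- Only the first vector has a `w`-coordinate, so it cannot occur in a vector reducing to `y`.
  have h0 : a 0 = 0 := by
    have := congrArg h.cS ha
    simpa using this
  have h1 := congrArg h.cX ha
  simp only [h0, zero_smul, zero_add, map_sum, map_smul, cX_asm] at h1
  rw [← h1]
  exact sum_mem fun i _ => Submodule.smul_mem _ _ (Submodule.subset_span ⟨i, rfl⟩)

/-- Passing from the lift to `Z` lowers the fibre dimension by at most one, so `Z` contains `r`
vectors independent over the residue field; the rank of the lift leaves no room for further
generators. -/
theorem isSplit_of_liftSub [FiniteDimensional (ZMod p) E] (hp : p ≠ 2)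
    (hφ : Function.Surjective φ) {r : ℕ}
    {Z : Submodule R (R ⊗[ZMod p] PerpQuot B e)} {b : R ⊗[ZMod p] PerpQuot B e}
    (hL : IsSplit (r + 1) (h.liftSub Z b)) : IsSplit r Z := by
  have h1 : r ≤ Module.finrank k (push φ Z) := by
    have h2 := (hL.push φ).finrank_eq
    rw [push_liftSub h hp] at h2
    have h3 := h.finrank_liftSub_le (push φ Z) (scal _ φ b)
    omega
  obtain ⟨x, hx, hli⟩ := exists_linearIndependent_of_le_finrank_push φ h1
  have h4 := h.reduction_le_span hL (h.asm_mem_liftSub_self hp Z b) (x := x)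
    (fun i => by rw [reduction_liftSub]; exact hx i) hli
  rw [reduction_liftSub] at h4
  have h5 : Z = Submodule.span R (Set.range x) := le_antisymm h4 <| by
    rw [Submodule.span_le]
    rintro _ ⟨i, rfl⟩
    exact hx i
  rw [h5]
  exact isSplit_span_of_linearIndependent hφ hli

theorem reduction_mono {N N' : Submodule R (R ⊗[ZMod p] E)} (hN : N ≤ N') :
    reduction B e N ≤ reduction B e N' :=
  Submodule.map_mono (Submodule.comap_mono hN)

/-- A vector of `L` pairing to `-1` with `e`, for a totally isotropic split `L` that does not
contain `e` at any geometric point. -/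
theorem exists_asm_one_mem [FiniteDimensional (ZMod p) E] [IsLocalRing R]
    (hnd : B.Nondegenerate) {σ : ℕ}
    (hdim : Module.finrank (ZMod p) E = 2 * σ + 2) {L : Submodule R (R ⊗[ZMod p] E)}
    (hL : IsSplit (σ + 1) L) (hiso : IsIsotropic B L)
    (hav : ∀ (k : Type u) [Field k] [IsAlgClosed k] [Algebra (ZMod p) k]
      (φ : R →+* k) [IsLocalHom φ], (1 : k) ⊗ₜ[ZMod p] e ∉ push φ L) :
    ∃ b t, h.asm b 1 t ∈ L := by
  -- A unit `w`-coordinate could be scaled to `1`. Otherwise `L` becomes orthogonal to `e` over an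
  -- algebraic closure of the residue field, and `L + ⟨e⟩` is isotropic of dimension `σ + 2`, more
  -- than half of `2σ + 2`.
  by_contra! hno
  have hmax : ∀ z ∈ L, h.cS z ∈ IsLocalRing.maximalIdeal R := by
    intro z hz
    rw [IsLocalRing.mem_maximalIdeal]
    intro hu
    obtain ⟨c, hc⟩ := hu.exists_left_inv
    refine hno (c • h.cX z) (c * h.cT z) ?_
    rw [← hc, ← asm_smul, asm_coords]
    exact L.smul_mem _ hz
  let κ := IsLocalRing.ResidueField R
  let K := AlgebraicClosure κ
  let ψ : R →+* K := (algebraMap κ K).comp (IsLocalRing.residue R)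
  have hψ : IsLocalHom ψ := by
    have : IsLocalHom (algebraMap κ K) := inferInstance
    exact RingHom.isLocalHom_comp _ _
  have hz : ∀ z ∈ push ψ L, h.cS z = 0 := by
    have : push ψ L ≤ LinearMap.ker (h.cS (R := K)) := by
      rw [push, Submodule.span_le]
      rintro _ ⟨z, hz, rfl⟩
      change h.cS (scal E ψ z) = 0
      rw [cS_scal]
      change algebraMap κ K (IsLocalRing.residue R (h.cS z)) = 0
      rw [(IsLocalRing.residue_eq_zero_iff _).2 (hmax z hz), map_zero]
    exact this
  have hmem := hav K ψ
  have hiso' : IsIsotropic B (push ψ L ⊔ Submodule.span K {(1 : K) ⊗ₜ[ZMod p] e}) := by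
    intro a ha c hc
    obtain ⟨a, ha₁, a', ha', rfl⟩ := Submodule.mem_sup.1 ha
    obtain ⟨c, hc₁, c', hc', rfl⟩ := Submodule.mem_sup.1 hc
    obtain ⟨a', rfl⟩ := Submodule.mem_span_singleton.1 ha'
    obtain ⟨c', rfl⟩ := Submodule.mem_span_singleton.1 hc'
    have h1 : ∀ z ∈ push ψ L, B.baseChange K (1 ⊗ₜ e) z = 0 := fun z hz' => by
      have := hz z hz'
      rwa [cS, LinearMap.neg_apply, neg_eq_zero] at this
    have h2 : B.baseChange K ((1 : K) ⊗ₜ[ZMod p] e) (1 ⊗ₜ e) = 0 := by simp [h.ee]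
    simp only [map_add, map_smul, LinearMap.add_apply, LinearMap.smul_apply, h1 c hc₁, h2,
      baseChange_symm h.symm a (1 ⊗ₜ e), h1 a ha₁, (hiso.push ψ) a ha₁ c hc₁, smul_zero, add_zero]
  have hrank := two_mul_finrank_le_of_isIsotropic h.symm hnd hiso'
  have hfr : Module.finrank K ↥(push ψ L ⊔ Submodule.span K {(1 : K) ⊗ₜ[ZMod p] e})
      = Module.finrank K (push ψ L) + 1 := by
    have h1 := Submodule.finrank_sup_add_finrank_inf_eq (push ψ L)
      (Submodule.span K {(1 : K) ⊗ₜ[ZMod p] e})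
    have h2 : push ψ L ⊓ Submodule.span K {(1 : K) ⊗ₜ[ZMod p] e} = ⊥ := by
      rw [eq_bot_iff]
      rintro z ⟨hz1, hz2⟩
      obtain ⟨c, rfl⟩ := Submodule.mem_span_singleton.1 hz2
      by_cases hc : c = 0
      · simp [hc]
      · exact absurd ((Submodule.smul_mem_iff _ hc).1 hz1) hmem
    have h3 : (1 : K) ⊗ₜ[ZMod p] e ≠ 0 := fun h0 => hmem (h0 ▸ zero_mem _)
    rw [h2, finrank_bot, finrank_span_singleton h3] at h1
    omega
  rw [hfr, (hL.push ψ).finrank_eq, hdim] at hrank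
  omega

/-- For a totally isotropic `K ⊆ k ⊗ e^⊥/e` of dimension `σ`, the dimension of `K + F^* K` is at
least `σ + 1` when the form on `E` is non-neutral. -/
theorem lt_finrank_addFrob [FiniteDimensional (ZMod p) E] {σ : ℕ}
    (hneutral : ¬ ∃ W : Submodule (ZMod p) E,
      Module.finrank (ZMod p) W = σ + 1 ∧ ∀ x ∈ W, ∀ y ∈ W, B x y = 0)
    {K : Submodule k (k ⊗[ZMod p] PerpQuot B e)} (hK : Module.finrank k K = σ)
    (hiso : IsIsotropic h.form K) : σ + 1 ≤ Module.finrank k (addFrob K) := by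
  -- If the dimension does not grow, `K` is Frobenius-stable and descends to an isotropic subspace
  -- of `e^⊥/e` of dimension at least `σ`. Together with `e`, `σ` independent vectors of it span an
  -- isotropic subspace of dimension `σ + 1` in `E`.
  by_contra! hlt
  have hle : K ≤ addFrob K := le_sup_left
  have heq : K = addFrob K := Submodule.eq_of_le_of_finrank_le hle (by omega)
  have hst : ∀ x ∈ K, scal _ (frob p k) x ∈ K := fun x hx => by
    rw [heq]
    exact Submodule.mem_sup_right (scal_mem_push _ hx)
  obtain ⟨W, hW, hWiso⟩ := exists_isotropic_of_frob_stable hst hiso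
  rw [hK] at hW
  obtain ⟨f, hf⟩ := exists_linearIndependent_of_le_finrank hW
  have hj : Function.Injective (perpSplit B e w h.ew) :=
    Function.LeftInverse.injective h.proj_perpSplit
  let g : Fin (σ + 1) → E := Fin.cons e fun i => perpSplit B e w h.ew (f i)
  have hg : LinearIndependent (ZMod p) g := by
    rw [linearIndependent_finCons]
    constructor
    · exact (hf.map' W.subtype W.ker_subtype).map' _ (LinearMap.ker_eq_bot.2 hj)
    · intro hmem
      have : Submodule.span (ZMod p) (Set.range fun i => perpSplit B e w h.ew (f i))
          ≤ LinearMap.ker (B w) := by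
        rw [Submodule.span_le]
        rintro _ ⟨i, rfl⟩
        exact h.form_w_perpSplit _
      have h1 : B w e = 0 := this hmem
      rw [h.we] at h1
      simp at h1
  refine hneutral ⟨Submodule.span (ZMod p) (Set.range g), ?_, ?_⟩
  · rw [finrank_span_eq_card hg, Fintype.card_fin]
  · have hgg : ∀ i j, B (g i) (g j) = 0 := by
      intro i j
      refine Fin.cases ?_ (fun i => ?_) i <;> refine Fin.cases ?_ (fun j => ?_) j
      · exact h.ee
      · exact h.form_e_perpSplit _
      · exact (h.symm.eq _ _).trans (h.form_e_perpSplit _)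
      · exact (h.form_perpSplit _ _).trans (hWiso _ (f i).2 _ (f j).2)
    intro x hx y hy
    refine Submodule.span_induction₂ (p := fun x y _ _ => B x y = 0) ?_ ?_ ?_ ?_ ?_ ?_ ?_ hx hy
    · rintro _ _ ⟨i, rfl⟩ ⟨j, rfl⟩
      exact hgg i j
    · intro y _; simp
    · intro y _; simp
    · intro x y z _ _ _ h1 h2; simp [h1, h2]
    · intro x y z _ _ _ h1 h2; simp [h1, h2]
    · intro r x y _ _ h; simp [h]
    · intro r x y _ _ h; simp [h]

/-- Both `L` and `F^* L` are lifts, so their reductions `Z` and `F^* Z` are visible. Equality can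
fail, because the reduction also contains `b - F^* b`. -/
theorem addFrob_le_reduction (hp : p ≠ 2) (Z : Submodule R (R ⊗[ZMod p] PerpQuot B e))
    (b : R ⊗[ZMod p] PerpQuot B e) : addFrob Z ≤ reduction B e (addFrob (h.liftSub Z b)) := by
  refine sup_le ?_ ?_
  · have := reduction_mono (B := B) (e := e) (le_sup_left : h.liftSub Z b ≤ addFrob _)
    rwa [reduction_liftSub] at this
  · have := reduction_mono (B := B) (e := e)
      (le_sup_right : push (frob p R) (h.liftSub Z b) ≤ addFrob (h.liftSub Z b))
    refine le_trans (le_of_eq ?_) this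
    rw [push_liftSub h hp, reduction_liftSub]

/-- If `L = liftSub K b` and `L + F^* L` are split of ranks `σ + 1` and `σ + 2`, then `K + F^* K`
is split of rank `σ + 1` and contains `b - F^* b`. -/
theorem isSplit_addFrob_of_liftSub [FiniteDimensional (ZMod p) E] (hp : p ≠ 2)
    (hφ : Function.Surjective φ) {σ : ℕ}
    (hneutral : ¬ ∃ W : Submodule (ZMod p) E,
      Module.finrank (ZMod p) W = σ + 1 ∧ ∀ x ∈ W, ∀ y ∈ W, B x y = 0)
    {K : Submodule R (R ⊗[ZMod p] PerpQuot B e)} (hK : IsSplit σ K)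
    (hiso : IsIsotropic h.form K) {b : R ⊗[ZMod p] PerpQuot B e}
    (hL : IsSplit (σ + 2) (addFrob (h.liftSub K b))) :
    IsSplit (σ + 1) (addFrob K) ∧ b - scal _ (frob p R) b ∈ addFrob K := by
  have h1 : σ + 1 ≤ Module.finrank k (push φ (addFrob K)) := by
    rw [push_addFrob]
    exact h.lt_finrank_addFrob hneutral (hK.push φ).finrank_eq (hiso.push φ)
  obtain ⟨x, hx, hli⟩ := exists_linearIndependent_of_le_finrank_push φ h1
  have hb : h.asm b 1 (h.halfSq b) ∈ addFrob (h.liftSub K b) :=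
    Submodule.mem_sup_left (h.asm_mem_liftSub_self hp K b)
  have hFb : h.asm (scal _ (frob p R) b) 1 (frob p R (h.halfSq b))
      ∈ addFrob (h.liftSub K b) := by
    have := scal_mem_push (frob p R) (h.asm_mem_liftSub_self hp K b)
    rw [scal_asm, map_one] at this
    exact Submodule.mem_sup_right this
  -- The rank `σ + 2` of `L + F^* L` makes the `σ + 1` vectors `x i` of `K + F^* K` generate its
  -- whole reduction, so the two modules coincide. The two lifts `w + b + …` and `w + F^* b + …`
  -- then differ by an element reducing into `K + F^* K`.
  have hle := h.reduction_le_span hL hb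
    (fun i => h.addFrob_le_reduction hp K b (hx i)) hli
  have hspan : Submodule.span R (Set.range x) ≤ addFrob K := by
    rw [Submodule.span_le]
    rintro _ ⟨i, rfl⟩
    exact hx i
  have heq : addFrob K = Submodule.span R (Set.range x) :=
    le_antisymm ((h.addFrob_le_reduction hp K b).trans hle) hspan
  refine ⟨heq ▸ isSplit_span_of_linearIndependent hφ hli, hspan (hle ?_)⟩
  rw [h.mem_reduction]
  have := sub_mem hb hFb
  rw [asm_sub, sub_self] at this
  exact ⟨_, this⟩

theorem isIsotropic_reduction {L : Submodule R (R ⊗[ZMod p] E)} (hL : IsIsotropic B L) :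
    IsIsotropic h.form (reduction B e L) := by
  intro x hx y hy
  obtain ⟨s, hs⟩ := h.mem_reduction.1 hx
  obtain ⟨t, ht⟩ := h.mem_reduction.1 hy
  have := hL _ hs _ ht
  rw [form_asm] at this
  linear_combination this

end HypPair

/-! ### Spreading out from stalks -/

section Spreading

open Topology

variable {p : ℕ} {X : FpScheme.{u} p} {V : Type v} [AddCommGroup V] [Module (ZMod p) V]

/-- Restriction of sections of `V ⊗ 𝒪_X`. -/
def resV {U U' : X.left.Opens} (h : U' ≤ U) (s : VSec V X U) : VSec V X U' :=
  scal V (X.left.presheaf.map (homOfLE h).op).hom s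

theorem germ_comp_res {U U' : X.left.Opens} (h : U' ≤ U) (y : X.left) (hy : y ∈ U') :
    (X.left.presheaf.germ U' y hy).hom.comp (X.left.presheaf.map (homOfLE h).op).hom
      = (X.left.presheaf.germ U y (h hy)).hom := by
  rw [← CommRingCat.hom_comp, TopCat.Presheaf.germ_res]

@[simp]
theorem germV_resV {U U' : X.left.Opens} (h : U' ≤ U) (y : X.left) (hy : y ∈ U')
    (s : VSec V X U) : germV y hy (resV h s) = germV y (h hy) s := by
  rw [germV, resV, scal_scal, germ_comp_res]; rfl

theorem exists_restriction {ι : Type*} {U U' : X.left.Opens} (h : U' ≤ U) (s : ι → VSec V X U) :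
    ∃ s' : ι → VSec V X U', ∀ (y : X.left) (hy : y ∈ U') (i : ι),
      germV y (h hy) (s i) = germV y hy (s' i) :=
  ⟨fun i => resV h (s i), fun y hy i => (germV_resV h y hy (s i)).symm⟩

theorem eventually_germ_eq {U : X.left.Opens} {x : X.left} (hx : x ∈ U) {s t : Γ(X.left, U)}
    (hst : X.left.presheaf.germ U x hx s = X.left.presheaf.germ U x hx t) :
    ∀ᶠ y in 𝓝 x, ∀ hy : y ∈ U,
      X.left.presheaf.germ U y hy s = X.left.presheaf.germ U y hy t := by
  obtain ⟨W, hxW, iU, iV, hW⟩ := X.left.presheaf.germ_eq x hx hx s t hst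
  filter_upwards [W.isOpen.mem_nhds hxW] with y hyW hy
  exact X.left.presheaf.germ_ext W hyW iU iV hW

/-- Finitely many germs come from sections over a common neighbourhood. -/
theorem exists_germ_eq_of_finite {ι : Type*} [Finite ι] {U : X.left.Opens} {x : X.left}
    (hx : x ∈ U) (c : ι → X.left.presheaf.stalk x) :
    ∃ (W : X.left.Opens) (_ : W ≤ U) (hxW : x ∈ W) (s : ι → Γ(X.left, W)),
      ∀ i, X.left.presheaf.germ W x hxW (s i) = c i := by
  choose W hWU hxW s hs using fun i => X.left.presheaf.exists_le_germ_eq (c i) hx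
  let W' : X.left.Opens := U ⊓ ⨅ i, W i
  have hle : ∀ i, W' ≤ W i := fun i => inf_le_right.trans (iInf_le _ i)
  have hxW' : x ∈ W' := by
    refine ⟨hx, ?_⟩
    change x ∈ ((⨅ i, W i : X.left.Opens) : Set X.left)
    rw [TopologicalSpace.Opens.coe_iInf, Set.mem_iInter]
    exact hxW
  refine ⟨W', inf_le_left, hxW', fun i => X.left.presheaf.map (homOfLE (hle i)).op (s i),
    fun i => ?_⟩
  rw [← hs i]
  exact X.left.presheaf.germ_res_apply ..

variable [Fact p.Prime] [FiniteDimensional (ZMod p) V]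

theorem exists_germV_eq_of_finite {ι : Type*} [Finite ι] {U : X.left.Opens} {x : X.left}
    (hx : x ∈ U) (z : ι → VStalk V X x) :
    ∃ (W : X.left.Opens) (_ : W ≤ U) (hxW : x ∈ W) (s : ι → VSec V X W),
      ∀ i, germV x hxW (s i) = z i := by
  let b := Module.finBasis (ZMod p) V
  let b' := b.baseChange (X.left.presheaf.stalk x)
  obtain ⟨W, hWU, hxW, s, hs⟩ := exists_germ_eq_of_finite hx
    (fun q : ι × Fin (Module.finrank (ZMod p) V) => b'.repr (z q.1) q.2)
  refine ⟨W, hWU, hxW, fun i => ∑ j, s (i, j) ⊗ₜ b j, fun i => ?_⟩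
  conv_rhs => rw [← b'.sum_repr (z i)]
  rw [germV, map_sum]
  refine Finset.sum_congr rfl fun j _ => ?_
  rw [scal_tmul, ← hs (i, j), Module.Basis.baseChange_apply, TensorProduct.smul_tmul',
    smul_eq_mul, mul_one]

theorem exists_germV_eq {U : X.left.Opens} {x : X.left}
    (hx : x ∈ U) (z : VStalk V X x) :
    ∃ (W : X.left.Opens) (_ : W ≤ U) (hxW : x ∈ W) (s : VSec V X W), germV x hxW s = z := by
  obtain ⟨W, h, hxW, s, hs⟩ := exists_germV_eq_of_finite hx (fun _ : Unit => z)
  exact ⟨W, h, hxW, s (), hs ()⟩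

theorem eventually_germV_eq {U : X.left.Opens} {x : X.left} (hx : x ∈ U) {s t : VSec V X U}
    (hst : germV x hx s = germV x hx t) :
    ∀ᶠ y in 𝓝 x, ∀ hy : y ∈ U, germV y hy s = germV y hy t := by
  let b := Module.finBasis (ZMod p) V
  have hrepr : ∀ (y : X.left) (hy : y ∈ U) (s : VSec V X U) i,
      (b.baseChange (X.left.presheaf.stalk y)).repr (germV y hy s) i
        = X.left.presheaf.germ U y hy ((b.baseChange Γ(X.left, U)).repr s i) :=
    fun y hy s i => repr_scal _ (b.baseChange _) (b.baseChange _)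
      (fun i => by simp only [Module.Basis.baseChange_apply, scal_tmul, map_one]) s i
  have hall : ∀ i, ∀ᶠ y in 𝓝 x, ∀ hy : y ∈ U,
      X.left.presheaf.germ U y hy ((b.baseChange Γ(X.left, U)).repr s i)
        = X.left.presheaf.germ U y hy ((b.baseChange Γ(X.left, U)).repr t i) := fun i =>
    eventually_germ_eq hx (by rw [← hrepr, ← hrepr, hst])
  filter_upwards [Filter.eventually_all.2 hall] with y hy hyU
  refine (b.baseChange (X.left.presheaf.stalk y)).repr.injective (Finsupp.ext fun i => ?_)
  rw [hrepr, hrepr, hy]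

/-- The finitely many coefficients of the relation at `x` are germs of functions, and the relation
itself persists near `x`. -/
theorem eventually_germV_mem_span {ι : Type*} [Fintype ι] {U : X.left.Opens} {x : X.left}
    (hx : x ∈ U) {s : ι → VSec V X U} {t : VSec V X U}
    (ht : germV x hx t ∈ Submodule.span (X.left.presheaf.stalk x)
      (Set.range fun i => germV x hx (s i))) :
    ∀ᶠ y in 𝓝 x, ∀ hy : y ∈ U,
      germV y hy t ∈ Submodule.span (X.left.presheaf.stalk y)
        (Set.range fun i => germV y hy (s i)) := by
  obtain ⟨c, hc⟩ := (Submodule.mem_span_range_iff_exists_fun _).1 ht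
  obtain ⟨W, hWU, hxW, d, hd⟩ := exists_germ_eq_of_finite hx c
  have key : ∀ y (hy : y ∈ W), germV y hy (∑ i, d i • resV hWU (s i))
      = ∑ i, X.left.presheaf.germ W y hy (d i) • germV y (hWU hy) (s i) := fun y hy => by
    rw [germV, map_sum]
    refine Finset.sum_congr rfl fun i _ => ?_
    rw [map_smulₛₗ]
    exact congrArg _ (germV_resV hWU y hy (s i))
  have h1 : germV x hxW (resV hWU t) = germV x hxW (∑ i, d i • resV hWU (s i)) := by
    rw [key, germV_resV, ← hc]
    simp only [hd]
  filter_upwards [eventually_germV_eq hxW h1, W.isOpen.mem_nhds hxW] with y hy hyW hyU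
  have h2 := hy hyW
  rw [key, germV_resV] at h2
  rw [h2]
  exact sum_mem fun i _ => Submodule.smul_mem _ _ (Submodule.subset_span ⟨i, rfl⟩)

/-- The family `K` is, locally on `X`, generated by finitely many sections of `V ⊗ 𝒪_X`. -/
def IsLocallyGenerated (K : StalkFamily V X) : Prop :=
  ∀ x : X.left, ∃ U : X.left.Opens, x ∈ U ∧ ∃ (n : ℕ) (s : Fin n → VSec V X U),
    ∀ (y : X.left) (hy : y ∈ U), K y = Submodule.span _ (Set.range fun i => germV y hy (s i))

omit [Fact p.Prime] [FiniteDimensional (ZMod p) V] in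
theorem IsLocallyGenerated.of_finite {K : StalkFamily V X}
    (hK : ∀ x : X.left, ∃ U : X.left.Opens, x ∈ U ∧ ∃ (ι : Type) (_ : Finite ι)
      (s : ι → VSec V X U), ∀ (y : X.left) (hy : y ∈ U),
        K y = Submodule.span _ (Set.range fun i => germV y hy (s i))) :
    IsLocallyGenerated K := by
  intro x
  obtain ⟨U, hxU, ι, _, s, hs⟩ := hK x
  obtain ⟨n, ⟨g⟩⟩ := Finite.exists_equiv_fin ι
  refine ⟨U, hxU, n, s ∘ g.symm, fun y hy => ?_⟩
  rw [hs y hy]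
  congr 1
  exact (g.symm.surjective.range_comp (fun i => germV y hy (s i))).symm

omit [Fact p.Prime] [FiniteDimensional (ZMod p) V] in
theorem IsLocallySplit.isLocallyGenerated {r : ℕ} {K : StalkFamily V X}
    (hK : IsLocallySplit r K) : IsLocallyGenerated K := by
  intro x
  obtain ⟨U, hxU, m, b, hb⟩ := hK x
  exact ⟨U, hxU, r, _, hb⟩

omit [Fact p.Prime] [FiniteDimensional (ZMod p) V] in
theorem IsLocallySplit.isSplit {r : ℕ} {K : StalkFamily V X} (hK : IsLocallySplit r K)
    (x : X.left) : IsSplit r (K x) := by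
  obtain ⟨U, hxU, m, b, hb⟩ := hK x
  obtain ⟨b', hb'⟩ := exists_basis_scal (X.left.presheaf.germ U x hxU).hom b
  refine ⟨m, b', ?_⟩
  rw [hb x hxU]
  congr 2
  funext i
  exact (hb' _).symm

/-- A locally generated family with split stalks is locally split. -/
theorem IsLocallyGenerated.isLocallySplit {r : ℕ} {K : StalkFamily V X}
    (hK : IsLocallyGenerated K) (hr : ∀ x, IsSplit r (K x)) : IsLocallySplit r K := by
  classical
  intro x
  obtain ⟨U, hxU, n, s, hs⟩ := hK x
  obtain ⟨m, β, hβ⟩ := hr x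
  obtain ⟨W, hWU, hxW, f, hf⟩ := exists_germV_eq_of_finite hxU β
  have hcard : Module.finrank (ZMod p) V = Fintype.card (Fin r ⊕ Fin m) := by
    rw [← Module.finrank_eq_card_basis β, Module.finrank_baseChange]
  let b : Module.Basis (Fin r ⊕ Fin m) Γ(X.left, W) (VSec V X W) :=
    ((Module.finBasis (ZMod p) V).baseChange Γ(X.left, W)).reindex
      ((finCongr hcard).trans (Fintype.equivFin _).symm)
  obtain ⟨bx, hbx⟩ := exists_basis_scal (X.left.presheaf.germ W x hxW).hom b
  -- The spread-out basis has invertible determinant at `x`, hence on a neighbourhood, where it is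
  -- still a basis.
  have hunit : IsUnit (X.left.presheaf.germ W x hxW (b.det f)) := by
    have h1 := det_scal _ b bx hbx f
    have h2 : scal V (X.left.presheaf.germ W x hxW).hom ∘ f = β := funext hf
    rw [h2] at h1
    exact h1 ▸ bx.isUnit_det β
  obtain ⟨W₁, i₁, hxW₁, hu⟩ := RingedSpace.isUnit_res_of_isUnit_germ
    X.left.toLocallyRingedSpace.toSheafedSpace W (b.det f) x hxW hunit
  have hW₁ : W₁ ≤ W := i₁.le
  have hKx := hs x hxU
  -- At `x` the given generators and the first `r` basis vectors span the same module. Each of these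
  -- finitely many memberships persists nearby, so the spans agree on a neighbourhood.
  have hA : ∀ i, ∀ᶠ y in 𝓝 x, ∀ hy : y ∈ W,
      germV y hy (resV hWU (s i)) ∈ Submodule.span (X.left.presheaf.stalk y)
        (Set.range fun j : Fin r => germV y hy (f (Sum.inl j))) := fun i => by
    refine eventually_germV_mem_span hxW ?_
    simp only [hf, germV_resV]
    rw [← hβ, hKx]
    exact Submodule.subset_span ⟨i, rfl⟩
  have hB : ∀ j : Fin r, ∀ᶠ y in 𝓝 x, ∀ hy : y ∈ W,
      germV y hy (f (Sum.inl j)) ∈ Submodule.span (X.left.presheaf.stalk y)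
        (Set.range fun i => germV y hy (resV hWU (s i))) := fun j => by
    refine eventually_germV_mem_span hxW ?_
    simp only [hf, germV_resV]
    rw [← hKx, hβ]
    exact Submodule.subset_span ⟨j, rfl⟩
  obtain ⟨T, hT, hTo, hxT⟩ := eventually_nhds_iff.1
    ((Filter.eventually_all.2 hA).and (Filter.eventually_all.2 hB))
  let W₂ : X.left.Opens := W₁ ⊓ ⟨T, hTo⟩
  have hW₂ : W₂ ≤ W := inf_le_left.trans hW₁
  have hu₂ : IsUnit ((X.left.presheaf.map (homOfLE hW₂).op).hom (b.det f)) := by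
    have h3 := hu.map (X.left.presheaf.map (homOfLE (inf_le_left : W₂ ≤ W₁)).op).hom
    have h4 : X.left.presheaf.map (homOfLE hW₂).op
        = X.left.presheaf.map i₁.op ≫
          X.left.presheaf.map (homOfLE (inf_le_left : W₂ ≤ W₁)).op := by
      rw [← Functor.map_comp]; rfl
    rw [h4]
    exact h3
  obtain ⟨b₂, hb₂⟩ := exists_basis_scal (X.left.presheaf.map (homOfLE hW₂).op).hom b
  rw [← det_scal _ b b₂ hb₂] at hu₂
  obtain ⟨d, hd⟩ := exists_basis_of_isUnit_det b₂ hu₂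
  refine ⟨W₂, ⟨hxW₁, hxT⟩, m, d, fun y hy => ?_⟩
  have hdg : ∀ j : Fin r, germV y hy (d (Sum.inl j)) = germV y (hW₂ hy) (f (Sum.inl j)) :=
    fun j => by
      rw [hd]
      exact germV_resV hW₂ y hy _
  simp only [hdg]
  rw [hs y (hWU (hW₂ hy))]
  obtain ⟨h5, h6⟩ := hT y hy.2
  apply le_antisymm
  · rw [Submodule.span_le]
    rintro _ ⟨i, rfl⟩
    have := h5 i (hW₂ hy)
    rwa [germV_resV] at this
  · rw [Submodule.span_le]
    rintro _ ⟨j, rfl⟩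
    have := h6 j (hW₂ hy)
    simpa only [germV_resV, SetLike.mem_coe] using this

omit [FiniteDimensional (ZMod p) V] in
theorem scal_frob_germV {U : X.left.Opens} {y : X.left} (hy : y ∈ U) (s : VSec V X U) :
    scal V (frob p _) (germV y hy s) = germV y hy (scal V (frob p _) s) := by
  rw [germV, germV, scal_scal, scal_scal, frob_comm]

omit [FiniteDimensional (ZMod p) V] in
theorem IsLocallyGenerated.addFrob {K : StalkFamily V X} (hK : IsLocallyGenerated K) :
    IsLocallyGenerated K.addFrob := by
  refine .of_finite fun x => ?_
  obtain ⟨U, hxU, n, s, hs⟩ := hK x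
  refine ⟨U, hxU, Fin n ⊕ Fin n, inferInstance, Sum.elim s fun i => scal V (frob p _) (s i),
    fun y hy => ?_⟩
  change CharSubspaces.addFrob (K y) = _
  rw [hs y hy, CharSubspaces.addFrob, push_span, ← Submodule.span_union, ← Set.range_comp]
  congr 1
  have : (fun i => germV y hy (Sum.elim s (fun i => scal V (frob p _) (s i)) i))
      = Sum.elim (fun i => germV y hy (s i))
          (scal V (frob p _) ∘ fun i => germV y hy (s i)) := by
    funext i
    rcases i with i | i
    · rfl
    · exact (scal_frob_germV hy _).symm
  rw [this, Set.Sum.elim_range]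

end Spreading

namespace HypPair

/-! ### The isomorphism `𝒰_V ≅ M^{⟨v⟩}` -/

variable {p : ℕ} [Fact p.Prime] {E : Type v} [AddCommGroup E] [Module (ZMod p) E]
  {B : LinearMap.BilinForm (ZMod p) E} {e w : E} (h : HypPair B e w)

/-- Subtracting from each generator its multiple of `w + b + t e` moves it into `R ⊗ e^⊥`. This
gives generators by a formula that makes sense for sections. -/
theorem reduction_span {R : Type u} [CommRing R] [Algebra (ZMod p) R] {ι : Type*} [Fintype ι]
    {s : ι → R ⊗[ZMod p] E} {b : R ⊗[ZMod p] PerpQuot B e} {t : R}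
    (hb : h.asm b 1 t ∈ Submodule.span R (Set.range s)) :
    reduction B e (Submodule.span R (Set.range s))
      = Submodule.span R (Set.range fun i => h.cX (s i) - h.cS (s i) • b) := by
  apply le_antisymm
  · intro x hx
    obtain ⟨q, hq⟩ := h.mem_reduction.1 hx
    obtain ⟨c, hc⟩ := (Submodule.mem_span_range_iff_exists_fun R).1 hq
    have h1 := congrArg h.cX hc
    have h2 := congrArg h.cS hc
    simp only [map_sum, map_smul, cX_asm, cS_asm, smul_eq_mul] at h1 h2
    refine (Submodule.mem_span_range_iff_exists_fun R).2 ⟨c, ?_⟩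
    simp only [smul_sub, Finset.sum_sub_distrib, smul_smul, ← Finset.sum_smul, h1, h2, zero_smul,
      sub_zero]
  · rw [Submodule.span_le]
    rintro _ ⟨i, rfl⟩
    refine h.mem_reduction.2 ⟨h.cT (s i) - h.cS (s i) * t, ?_⟩
    have := sub_mem (Submodule.subset_span ⟨i, rfl⟩ : s i ∈ Submodule.span R (Set.range s))
      (Submodule.smul_mem _ (h.cS (s i)) hb)
    rw [asm_smul, mul_one] at this
    nth_rewrite 1 [← h.asm_coords (s i)] at this
    rwa [asm_sub, sub_self] at this

variable {X : FpScheme.{u} p}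

theorem germV_asm {U : X.left.Opens} {y : X.left} (hy : y ∈ U) (x : VSec (PerpQuot B e) X U)
    (s t : Γ(X.left, U)) :
    germV y hy (h.asm x s t) = h.asm (germV y hy x) (X.left.presheaf.germ U y hy s)
      (X.left.presheaf.germ U y hy t) := h.scal_asm _ x s t

theorem germ_halfSq {U : X.left.Opens} {y : X.left} (hy : y ∈ U)
    (x : VSec (PerpQuot B e) X U) :
    X.left.presheaf.germ U y hy (h.halfSq x) = h.halfSq (germV y hy x) :=
  (h.scal_halfSq (X.left.presheaf.germ U y hy).hom x).symm

theorem germ_form {U : X.left.Opens} {y : X.left} (hy : y ∈ U)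
    (x x' : VSec (PerpQuot B e) X U) :
    X.left.presheaf.germ U y hy (h.form.baseChange Γ(X.left, U) x x')
      = h.form.baseChange (X.left.presheaf.stalk y) (germV y hy x) (germV y hy x') :=
  (baseChange_scal h.form (X.left.presheaf.germ U y hy).hom x x').symm

theorem isLocallyGenerated_liftSub (hp : p ≠ 2) {K : StalkFamily (PerpQuot B e) X}
    (hK : IsLocallyGenerated K) {L : StalkFamily E X}
    (hL : ∀ x : X.left, ∃ U : X.left.Opens, x ∈ U ∧
      ∃ b : VSec (PerpQuot B e) X U, ∀ (y : X.left) (hy : y ∈ U),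
        L y = h.liftSub (K y) (germV y hy b)) :
    IsLocallyGenerated L := by
  refine .of_finite fun x => ?_
  obtain ⟨U, hxU, n, s, hs⟩ := hK x
  obtain ⟨W, hxW, b, hb⟩ := hL x
  have hU : U ⊓ W ≤ U := inf_le_left
  have hW : U ⊓ W ≤ W := inf_le_right
  obtain ⟨s', e1⟩ := exists_restriction hU s
  obtain ⟨b', e2⟩ := exists_restriction hW fun _ : Unit => b
  replace e2 := fun y hy => e2 y hy ()
  generalize b' () = b' at e2
  refine ⟨U ⊓ W, ⟨hxU, hxW⟩, Fin (n + 1), inferInstance, Fin.cons (h.asm b' 1 (h.halfSq b'))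
    fun i => h.asm (s' i) 0 (h.form.baseChange _ (s' i) b'), fun y hy => ?_⟩
  have e3 : (fun i => germV y hy ((Fin.cons (h.asm b' 1 (h.halfSq b'))
      fun i => h.asm (s' i) 0 (h.form.baseChange _ (s' i) b') :
        Fin (n + 1) → VSec E X (U ⊓ W)) i)) = Fin.cons (h.asm (germV y hy b') 1
      (h.halfSq (germV y hy b'))) fun i => h.asm (germV y hy (s' i)) 0
        (h.form.baseChange _ (germV y hy (s' i)) (germV y hy b')) := by
    funext i
    refine Fin.cases ?_ (fun j => ?_) i
    · change germV y hy (h.asm b' 1 (h.halfSq b')) = _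
      rw [germV_asm, map_one, germ_halfSq]
      rfl
    · change germV y hy (h.asm (s' j) 0 (h.form.baseChange _ (s' j) b')) = _
      rw [germV_asm, map_zero, germ_form]
      rfl
  rw [hb y (hW hy), hs y (hU hy), liftSub_span_fin h hp, e3, e2 y hy]
  simp only [e1 y hy]

/-! ### From points of `𝒰_V` to characteristic subspaces of `E` -/

section Lift

variable {σ : ℕ} (s : UPoint h.form σ X)

theorem liftSub_eq_of_mk_eq (hp : p ≠ 2) {x : X.left} {b b' : VStalk (PerpQuot B e) X x}
    (hb : Submodule.Quotient.mk b = s.val x) (hb' : Submodule.Quotient.mk b' = s.val x) :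
    h.liftSub (s.base.K x) b = h.liftSub (s.base.K x) b' :=
  h.liftSub_congr hp (s.base.isotropic x) ((Submodule.Quotient.eq _).1 (hb.trans hb'.symm))

/-- The family of submodules associated with a point of `𝒰_V`. -/
def liftFamily : StalkFamily E X := fun x => h.liftSub (s.base.K x) (s.val x).out

theorem liftFamily_eq (hp : p ≠ 2) {x : X.left} {b : VStalk (PerpQuot B e) X x}
    (hb : Submodule.Quotient.mk b = s.val x) :
    h.liftFamily s x = h.liftSub (s.base.K x) b :=
  h.liftSub_eq_of_mk_eq s hp (Quotient.out_eq _) hb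

theorem isLocallyGenerated_liftFamily (hp : p ≠ 2) : IsLocallyGenerated (h.liftFamily s) := by
  refine h.isLocallyGenerated_liftSub hp s.base.split.isLocallyGenerated fun x => ?_
  obtain ⟨U, hxU, b, hb⟩ := s.sec.1.2 x
  exact ⟨U, hxU, b, fun y hy => h.liftFamily_eq s hp (hb y hy).symm⟩

theorem sub_frob_mem {x : X.left} {b : VStalk (PerpQuot B e) X x}
    (hb : Submodule.Quotient.mk b = s.val x) :
    b - scal _ (frob p _) b ∈ addFrob (s.base.K x) := by
  have h1 : oneSubFrob (s.base.K x) (s.val x) = 0 :=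
    congrFun (congrArg Subtype.val s.sec.2) x
  rwa [← hb, oneSubFrob_mk, Submodule.Quotient.mk_eq_zero] at h1

variable [FiniteDimensional (ZMod p) E]

/-- The characteristic subspace of `E` associated with a point of `𝒰_V`. -/
def lift (hp : p ≠ 2) : CharSub B (σ + 1) X where
  K := h.liftFamily s
  split := (h.isLocallyGenerated_liftFamily s hp).isLocallySplit fun x =>
    h.isSplit_liftSub hp IsLocalRing.residue_surjective (s.base.split.isSplit x) _
  split_addFrob := (h.isLocallyGenerated_liftFamily s hp).addFrob.isLocallySplit fun x => by
    -- The chosen representative is replaced by one with `F^* b - b ∈ F^* K`, as `addFrob_liftSub`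
    -- requires.
    obtain ⟨b, hb, hb'⟩ := exists_sub_frob_mem
      (sub_frob_mem h s (x := x) (b := (s.val x).out) (Quotient.out_eq _))
    have h1 : Submodule.Quotient.mk b = s.val x :=
      ((Submodule.Quotient.eq _).2 hb).trans (Quotient.out_eq _)
    change IsSplit _ (addFrob (h.liftFamily s x))
    rw [h.liftFamily_eq s hp h1, addFrob_liftSub h hp (s.base.isotropic x) hb']
    exact h.isSplit_liftSub hp IsLocalRing.residue_surjective (s.base.split_addFrob.isSplit x) _
  isotropic x := h.isIsotropic_liftSub hp (s.base.isotropic x) _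

/-- The vector `e` has `x = 0` and `s = 0`, so membership in a lift would force its `e`-coordinate
`1` to vanish. -/
theorem lift_avoids (hp : p ≠ 2) : (h.lift s hp).Avoids e := by
  intro x k _ _ _ φ _ hmem
  have h1 : (1 : k) ⊗ₜ[ZMod p] e = h.asm 0 0 1 := by simp [asm]
  change _ ∈ push φ (h.liftSub _ _) at hmem
  rw [push_liftSub h hp, h1, asm_mem_liftSub] at hmem
  simpa using hmem.2

theorem lift_pullback (hp : p ≠ 2) {T : FpScheme.{u} p} (f : T ⟶ X) :
    h.lift (s.pullback f) hp = (h.lift s hp).pullback f := by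
  refine CharSub.ext (funext fun t => ?_)
  have h1 : Submodule.Quotient.mk (s.val (f.left t)).out = s.val (f.left t) := Quotient.out_eq _
  refine (h.liftFamily_eq (s.pullback f) hp (UPoint.pullback_val f s t h1.symm).symm).trans ?_
  exact (h.push_liftSub hp _ _ _).symm

end Lift

/-! ### From characteristic subspaces avoiding `e` to points of `𝒰_V` -/

section Reduce

variable [FiniteDimensional (ZMod p) E] {σ : ℕ} {L : CharSub B (σ + 1) X}

/-- The vector `w + b + t e` found in one stalk extends to a section that stays in `L` nearby; this
supplies both the local lift of the section of `𝒰_V` and local generators of the reduction. -/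
theorem exists_section_mem (hnd : B.Nondegenerate)
    (hdim : Module.finrank (ZMod p) E = 2 * σ + 2) (hL : L.Avoids e) (x : X.left) :
    ∃ U : X.left.Opens, x ∈ U ∧ ∃ (b : VSec (PerpQuot B e) X U) (n : ℕ) (s : Fin n → VSec E X U),
      ∀ (y : X.left) (hy : y ∈ U), (∃ t, h.asm (germV y hy b) 1 t ∈ L.K y) ∧
        L.K y = Submodule.span _ (Set.range fun i => germV y hy (s i)) := by
  obtain ⟨b, t, hbt⟩ := h.exists_asm_one_mem hnd hdim (L.split.isSplit x) (L.isotropic x) (hL x)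
  obtain ⟨U, hxU, n, s, hs⟩ := L.split.isLocallyGenerated x
  obtain ⟨W, hWU, hxW, b, rfl⟩ := exists_germV_eq hxU b
  obtain ⟨W', hW', hxW', t, rfl⟩ := X.left.presheaf.exists_le_germ_eq t hxW
  let b' : VSec (PerpQuot B e) X W' := resV hW' b
  let s' : Fin n → VSec E X W' := fun i => resV (hW'.trans hWU) (s i)
  have hbW : germV x hxW b = germV x hxW' b' := (germV_resV hW' x hxW' b).symm
  have hs' : ∀ (y : X.left) (hy : y ∈ W'),
      L.K y = Submodule.span _ (Set.range fun i => germV y hy (s' i)) := fun y hy => by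
    simp only [s', germV_resV]
    exact hs y (hWU (hW' hy))
  have hmem : germV x hxW' (h.asm b' 1 t) ∈ Submodule.span (X.left.presheaf.stalk x)
      (Set.range fun i => germV x hxW' (s' i)) := by
    rw [← hs', germV_asm, ← hbW, map_one]
    exact hbt
  obtain ⟨T, hT, hTo, hxT⟩ := eventually_nhds_iff.1 (eventually_germV_mem_span hxW' hmem)
  let W₂ : X.left.Opens := W' ⊓ ⟨T, hTo⟩
  have hW₂ : W₂ ≤ W' := inf_le_left
  refine ⟨W₂, ⟨hxW', hxT⟩, resV hW₂ b', n, fun i => resV hW₂ (s' i), fun y hy => ⟨?_, ?_⟩⟩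
  · have h1 := hT y hy.2 hy.1
    rw [← hs', germV_asm, map_one] at h1
    rw [germV_resV]
    exact ⟨_, h1⟩
  · simp only [germV_resV]
    exact hs' y hy.1

include h in
theorem isLocallyGenerated_reduction (hnd : B.Nondegenerate)
    (hdim : Module.finrank (ZMod p) E = 2 * σ + 2) (hL : L.Avoids e) :
    IsLocallyGenerated (X := X) fun x => reduction B e (L.K x) := by
  intro x
  obtain ⟨U, hxU, b, n, s, hs⟩ := h.exists_section_mem hnd hdim hL x
  refine ⟨U, hxU, n, fun i => h.cX (s i) - h.cS (s i) • b, fun y hy => ?_⟩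
  obtain ⟨⟨t, ht⟩, hspan⟩ := hs y hy
  rw [hspan] at ht
  refine (congrArg (reduction B e) hspan).trans ((h.reduction_span ht).trans ?_)
  congr 2
  funext i
  simp only [germV, cX_scal, cS_scal, map_sub, map_smulₛₗ]

theorem exists_asm_mem (hnd : B.Nondegenerate)
    (hdim : Module.finrank (ZMod p) E = 2 * σ + 2) (hL : L.Avoids e) (x : X.left) :
    ∃ b t, h.asm b 1 t ∈ L.K x :=
  h.exists_asm_one_mem hnd hdim (L.split.isSplit x) (L.isotropic x) (hL x)

-- The difference of two such vectors has `w`-coordinate `0`, so it lies in the part of `L` that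
-- reduces to `e^⊥/e`. Hence `L` determines a class, whatever vector is chosen.
omit [FiniteDimensional (ZMod p) E] in
theorem mk_eq_mk_of_asm_mem {x : X.left} {b b' : VStalk (PerpQuot B e) X x}
    {t t' : X.left.presheaf.stalk x} (hb : h.asm b 1 t ∈ L.K x) (hb' : h.asm b' 1 t' ∈ L.K x) :
    (Submodule.Quotient.mk b : VStalk (PerpQuot B e) X x ⧸ reduction B e (L.K x))
      = Submodule.Quotient.mk b' := by
  rw [Submodule.Quotient.eq, h.mem_reduction]
  have := sub_mem hb hb'
  rw [asm_sub, sub_self] at this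
  exact ⟨_, this⟩

variable (hp : p ≠ 2) (hnd : B.Nondegenerate)
  (hdim : Module.finrank (ZMod p) E = 2 * σ + 2)
  (hneutral : ¬ ∃ W : Submodule (ZMod p) E,
      Module.finrank (ZMod p) W = σ + 1 ∧ ∀ x ∈ W, ∀ y ∈ W, B x y = 0) (hL : L.Avoids e)

include h hp hnd hdim hL in
theorem isSplit_reduction (x : X.left) : IsSplit σ (reduction B e (L.K x)) := by
  obtain ⟨b, t, hb⟩ := h.exists_asm_mem hnd hdim hL x
  refine h.isSplit_of_liftSub hp IsLocalRing.residue_surjective (b := b) ?_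
  rw [← h.eq_liftSub hp (L.isotropic x) hb]
  exact L.split.isSplit x

include h hp hnd hdim hneutral hL in
theorem isSplit_addFrob_reduction (x : X.left) {b : VStalk (PerpQuot B e) X x}
    {t : X.left.presheaf.stalk x} (hb : h.asm b 1 t ∈ L.K x) :
    IsSplit (σ + 1) (addFrob (reduction B e (L.K x))) ∧
      b - scal _ (frob p _) b ∈ addFrob (reduction B e (L.K x)) := by
  refine h.isSplit_addFrob_of_liftSub hp IsLocalRing.residue_surjective hneutral
    (h.isSplit_reduction hp hnd hdim hL x) (h.isIsotropic_reduction (L.isotropic x)) ?_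
  rw [← h.eq_liftSub hp (L.isotropic x) hb]
  exact L.split_addFrob.isSplit x

/-- The reduction to `e^⊥ / e` of a characteristic subspace of `E` that avoids `e`. -/
def reduce : CharSub h.form σ X where
  K x := reduction B e (L.K x)
  split := (h.isLocallyGenerated_reduction hnd hdim hL).isLocallySplit
    (h.isSplit_reduction hp hnd hdim hL)
  split_addFrob := (h.isLocallyGenerated_reduction hnd hdim hL).addFrob.isLocallySplit fun x => by
    obtain ⟨b, t, hb⟩ := h.exists_asm_mem hnd hdim hL x
    exact (h.isSplit_addFrob_reduction hp hnd hdim hneutral hL x hb).1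
  isotropic x := h.isIsotropic_reduction (L.isotropic x)

/-- The point of `𝒰_V` given by a characteristic subspace of `E` that avoids `e`. -/
def reducePoint : UPoint h.form σ X where
  base := h.reduce hp hnd hdim hneutral hL
  -- The choices in different stalks are unrelated, but their classes are canonical and so agree
  -- locally with that of a single section `b`.
  sec := ⟨⟨fun x => Submodule.Quotient.mk (h.exists_asm_mem hnd hdim hL x).choose, fun x => by
      obtain ⟨U, hxU, b, n, s, hs⟩ := h.exists_section_mem hnd hdim hL x
      refine ⟨U, hxU, b, fun y hy => ?_⟩
      obtain ⟨⟨t, ht⟩, -⟩ := hs y hy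
      exact h.mk_eq_mk_of_asm_mem (h.exists_asm_mem hnd hdim hL y).choose_spec.choose_spec ht⟩, by
    refine Subtype.ext <| funext fun x => ?_
    change oneSubFrob (reduction B e (L.K x)) (Submodule.Quotient.mk _) = 0
    rw [oneSubFrob_mk, Submodule.Quotient.mk_eq_zero]
    exact (h.isSplit_addFrob_reduction hp hnd hdim hneutral hL x
      (h.exists_asm_mem hnd hdim hL x).choose_spec.choose_spec).2⟩

theorem reducePoint_val {x : X.left} {b : VStalk (PerpQuot B e) X x}
    {t : X.left.presheaf.stalk x} (hb : h.asm b 1 t ∈ L.K x) :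
    (h.reducePoint hp hnd hdim hneutral hL).val x = Submodule.Quotient.mk b :=
  h.mk_eq_mk_of_asm_mem (h.exists_asm_mem hnd hdim hL x).choose_spec.choose_spec hb

theorem lift_reducePoint : h.lift (h.reducePoint hp hnd hdim hneutral hL) hp = L := by
  refine CharSub.ext (funext fun x => ?_)
  obtain ⟨b, t, hb⟩ := h.exists_asm_mem hnd hdim hL x
  refine (h.liftFamily_eq _ hp (h.reducePoint_val hp hnd hdim hneutral hL hb).symm).trans ?_
  exact (h.eq_liftSub hp (L.isotropic x) hb).symm

theorem reduce_lift_K (s : UPoint h.form σ X) (x : X.left) :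
    reduction B e ((h.lift s hp).K x) = s.base.K x := h.reduction_liftSub _ _

theorem reducePoint_lift (s : UPoint h.form σ X) :
    h.reducePoint hp hnd hdim hneutral (h.lift_avoids s hp) = s := by
  refine UPoint.ext_of (funext fun x => h.reduce_lift_K hp s x) fun x => ?_
  exact ⟨(s.val x).out, h.reducePoint_val hp hnd hdim hneutral (h.lift_avoids s hp)
    (h.asm_mem_liftSub_self hp _ _), (Quotient.out_eq _).symm⟩

/-- Intersecting with `e^⊥` need not commute with arbitrary base change; here it does because `L` is
a lift, and lifts are compatible with both operations. -/
theorem reduce_pullback {T : FpScheme.{u} p} (f : T ⟶ X) :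
    h.reduce hp hnd hdim hneutral (hL.pullback f)
      = (h.reduce hp hnd hdim hneutral hL).pullback f := by
  refine CharSub.ext (funext fun t => ?_)
  obtain ⟨b, t', hb⟩ := h.exists_asm_mem hnd hdim hL (f.left t)
  change reduction B e (push (stalkHom f t) (L.K (f.left t)))
    = push (stalkHom f t) (reduction B e (L.K (f.left t)))
  conv_lhs => rw [h.eq_liftSub hp (L.isotropic _) hb, push_liftSub h hp, reduction_liftSub]

end Reduce

/-! ### The morphism `π_v` and the isomorphism as natural transformations -/

variable [FiniteDimensional (ZMod p) E] {σ : ℕ} (hp : p ≠ 2) (hnd : B.Nondegenerate)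
  (hdim : Module.finrank (ZMod p) E = 2 * σ + 2)
  (hneutral : ¬ ∃ W : Submodule (ZMod p) E,
      Module.finrank (ZMod p) W = σ + 1 ∧ ∀ x ∈ W, ∀ y ∈ W, B x y = 0)

/-- The morphism `π_v`. -/
def reduceNatTrans : avoidFunctor.{u} B (σ + 1) e ⟶ charFunctor.{u} h.form σ where
  app _ := ↾ fun L => h.reduce hp hnd hdim hneutral L.2
  naturality _ _ f := ConcreteCategory.hom_ext _ _ fun L =>
    h.reduce_pullback hp hnd hdim hneutral L.2 f.unop

/-- The isomorphism `𝒰_V ≅ M^{⟨v⟩}`. -/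
def liftIso : uFunctor.{u} h.form σ ≅ avoidFunctor.{u} B (σ + 1) e :=
  NatIso.ofComponents
    (fun X => Equiv.toIso
      { toFun := fun s : UPoint h.form σ X.unop =>
          (⟨h.lift s hp, h.lift_avoids s hp⟩ : {L : CharSub B (σ + 1) X.unop // L.Avoids e})
        invFun := fun L => h.reducePoint hp hnd hdim hneutral L.2
        left_inv := fun s => h.reducePoint_lift hp hnd hdim hneutral s
        right_inv := fun L => Subtype.ext (h.lift_reducePoint hp hnd hdim hneutral L.2) })
    (fun f => ConcreteCategory.hom_ext _ _ fun s => Subtype.ext (h.lift_pullback s hp f.unop))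

end HypPair

end CharSubspaces

end

open CharSubspaces
theorem mainTheorem9 {p : ℕ} [Fact p.Prime] (hp : p ≠ 2) (σ : ℕ)
    {E : Type v} [AddCommGroup E] [Module (ZMod p) E] [FiniteDimensional (ZMod p) E]
    (B : LinearMap.BilinForm (ZMod p) E) (hsymm : B.IsSymm) (hnondeg : B.Nondegenerate)
    (hdim : Module.finrank (ZMod p) E = 2 * σ + 2)
    (hneutral : ¬ ∃ W : Submodule (ZMod p) E,
      Module.finrank (ZMod p) W = σ + 1 ∧ ∀ x ∈ W, ∀ y ∈ W, B x y = 0)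
    (e w : E) (he : e ≠ 0) (hee : B e e = 0) (hww : B w w = 0) (hew : B e w = -1) :
    ∃ (π : avoidFunctor.{u} B (σ + 1) e ⟶ charFunctor.{u} (perpForm B hsymm e) σ)
      (f : uFunctor.{u} (perpForm B hsymm e) σ ≅ avoidFunctor.{u} B (σ + 1) e),
      (∀ (X : FpScheme.{u} p) (L : CharSub B (σ + 1) X) (hL : L.Avoids e) (x : X.left),
        (π.app (op X) ⟨L, hL⟩ : CharSub (perpForm B hsymm e) σ X).K x
          = reduction B e (L.K x)) ∧
      f.hom ≫ π = uProj (perpForm B hsymm e) σ ∧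
      ∀ (X : FpScheme.{u} p) (s : UPoint (perpForm B hsymm e) σ X) (x : X.left)
        (y : Fin σ → VStalk (PerpQuot B e) X x) (b : VStalk (PerpQuot B e) X x),
        Submodule.span _ (Set.range y) = s.base.K x →
        Submodule.Quotient.mk b = s.val x →
        (f.hom.app (op X) s : {L : CharSub B (σ + 1) X // L.Avoids e}).1.K x =
          Submodule.span (X.left.presheaf.stalk x)
            (Set.range (fun i =>
              (perpSplit B e w hew).baseChange (X.left.presheaf.stalk x) (y i) +
                ((perpForm B hsymm e).baseChange (X.left.presheaf.stalk x) (y i) b)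
                  ⊗ₜ[ZMod p] e) ∪
            {(1 : X.left.presheaf.stalk x) ⊗ₜ[ZMod p] w +
              (perpSplit B e w hew).baseChange (X.left.presheaf.stalk x) b +
              ((2 : ZMod p)⁻¹ •
                ((perpForm B hsymm e).baseChange (X.left.presheaf.stalk x) b b))
                  ⊗ₜ[ZMod p] e})
 := by
  let h : HypPair B e w := ⟨hsymm, hee, hww, hew⟩
  refine ⟨h.reduceNatTrans hp hnondeg hdim hneutral, h.liftIso hp hnondeg hdim hneutral,
    fun X L hL x => rfl, ?_, ?_⟩
  · refine NatTrans.ext (funext fun X => ConcreteCategory.hom_ext _ _ fun s => ?_)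
    exact CharSub.ext (funext fun x => h.reduce_lift_K hp s x)
  · intro X s x y b hy hb
    refine (h.liftFamily_eq s hp hb).trans ?_
    rw [← hy, h.liftSub_span hp]
    simp only [HypPair.asm, TensorProduct.zero_tmul, add_zero, HypPair.halfSq]
    congr 3
    abel
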